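/- Let $N\ge 4$, let $\Sigma$ be a smooth manifold of dimension $N-1$ (Hausdorff, second countable), and let $\mathcal V_\Sigma\to\Sigma$ be a smooth vector bundle of rank $N$ with a smooth fibre metric $\eta$ of Lorentzian signature $(-,+,\dots,+)$. Put $\Omega_\partial^{i,j}=\Omega^i(\Sigma,\bigwedge^j\mathcal V_\Sigma)$ (smooth forms); products are wedge products in both the form and the internal indices, with signs given by the total degree $i+j$. Let $e\in\Omega_\partial^{1,1}$ be a boundary coframe, i.e. a smooth fibrewise injective bundle map $e:T\Sigma\to\mathcal V_\Sigma$, such that the induced metric $g^\partial=e^*\eta$ is degenerate at every point of $\Sigma$, and let $e_n\in\Omega_\partial^{0,1}$ be a section of $\mathcal V_\Sigma$ with $e_n(x)\notin e(T_x\Sigma)$ for all $x\in\Sigma$. Fix a smooth $\eta$-compatible reference connection $\omega_0$ on $\mathcal V_\Sigma$, and identify $\omega\in\Omega_\partial^{1,2}$ with the connection $\omega_0+\omega$ through $\bigwedge^2\mathcal V_\Sigma\cong\mathfrak{so}(\mathcal V_\Sigma,\eta)$; $d_\omega$ is the exterior covariant derivative of this connection, so that $d_\omega e\in\Omega_\partial^{2,1}$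 is $d_\omega e(X,Y)=\nabla^\omega_X(eY)-\nabla^\omega_Y(eX)-e[X,Y]$. Let $W_k^{\partial,(i,j)}:\Omega_\partial^{i,j}\to\Omega_\partial^{i+k,j+k}$, $X\mapsto X\wedge e^k$, and let $\varrho:\Omega_\partial^{1,2}\to\Omega_\partial^{2,1}$, $\varrho(X)=[X,e]$, that is, $[X,e]_{\mu\nu}^a=X_\mu^{ab}\eta_{bc}e_\nu^c-X_\nu^{ab}\eta_{bc}e_\mu^c$. Let $J$ be a linear complement of $\varrho(\operatorname{Ker}W_{N-3}^{\partial,(1,2)})$ in $\Omega_\partial^{2,1}$ and put $$\mathcal T=\operatorname{Ker}W_{N-3}^{\partial,(2,1)}\cap J,\qquad \mathcal K=\operatorname{Ker}W_{N-3}^{\partial,(1,2)}\cap\operatorname{Ker}\varrho .$$ Let $p_{\mathcal K}:\Omega_\partial^{1,2}\to\mathcal K$ be a linear projection onto $\mathcal K$. Let $h$ be a Riemannian metric on $\Sigma$, extended to a positive definite fibre metric on $\mathcal V_\Sigma$ for which $e$ is isometric and $e_n$ is orthogonal to $e(T\Sigma)$, and let $p_{\mathcal T}:\Omega_\partial^{2,1}\to\mathcal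 T$ be the orthogonal projection onto $\mathcal T$ for the induced pointwise inner product on $\bigwedge^2T^*\Sigma\otimes\mathcal V_\Sigma$ (assumed to exist, as it does e.g. when $J$ is the pointwise orthogonal complement). Then every $\widetilde\omega\in\Omega_\partial^{1,2}$ can be written in a unique way as $\widetilde\omega=\omega+v$ with $\omega,v\in\Omega_\partial^{1,2}$ satisfying $$e^{N-3}v=0,\qquad e_ne^{N-4}d_\omega e-e_ne^{N-4}p_{\mathcal T}(d_\omega e)\in\operatorname{Im}W_{N-3}^{\partial,(1,1)},\qquad p_{\mathcal K}v=0 .$$ -/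

import Mathlib

open Bundle Module
open scoped Manifold ContDiff

noncomputable section

namespace PalatiniCartan

/-! Throughout, `S` is the boundary manifold (modelled on `E`, so that `dim S = dim E`) and `V` is a
vector bundle over `S` with model fibre `F`, playing the role of the restricted bundle `𝒱_Σ`. -/

section Basic

variable (E : Type*) [NormedAddCommGroup E] [NormedSpace ℝ E]
  {S : Type*} [TopologicalSpace S] [ChartedSpace E S]
  (V : S → Type*) [∀ x, AddCommGroup (V x)] [∀ x, Module ℝ (V x)]

/-- The algebra `Λ(T_x^*S ⊕ V_x) = ⨁_{i,j} Λ^i T_x^*S ⊗ Λ^j V_x`. Its product is the wedge product on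
both the form indices and the internal indices, and bihomogeneous elements satisfy
`α β = (-1)^((i+j)(k+l)) β α`, the sign rule of the total degree. -/
abbrev FormFibre (x : S) : Type _ :=
  ExteriorAlgebra ℝ (Dual ℝ (TangentSpace 𝓘(ℝ, E) x) × V x)

/-- Not necessarily smooth fields of forms with values in `ΛV`; multiplication is the pointwise
wedge product. -/
abbrev FormField : Type _ := (x : S) → FormFibre E V x

/-- A covector as an element of bidegree `(1, 0)`. -/
def covec (x : S) : Dual ℝ (TangentSpace 𝓘(ℝ, E) x) →ₗ[ℝ] FormFibre E V x :=
  ExteriorAlgebra.ι ℝ ∘ₗ LinearMap.inl ℝ _ _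

/-- A vector of `V_x` as an element of bidegree `(0, 1)`. -/
def vec (x : S) : V x →ₗ[ℝ] FormFibre E V x :=
  ExteriorAlgebra.ι ℝ ∘ₗ LinearMap.inr ℝ _ _

/-- The component in `V_x` (bidegree `(0, 1)`) of an element. -/
def vecPart (x : S) : FormFibre E V x →ₗ[ℝ] V x :=
  LinearMap.snd ℝ _ _ ∘ₗ ExteriorAlgebra.ιInv

/-- `Λ^i T_x^*S ⊗ Λ^j V_x`, spanned by the products of `i` covectors and `j` vectors. -/
def bidegree (i j : ℕ) (x : S) : Submodule ℝ (FormFibre E V x) :=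
  LinearMap.range (covec E V x) ^ i * LinearMap.range (vec E V x) ^ j

variable {E V}

/-- Interior product `ι_u` with a tangent vector (it removes the first form index). -/
def insertVec {x : S} (u : TangentSpace 𝓘(ℝ, E) x) : FormFibre E V x →ₗ[ℝ] FormFibre E V x :=
  CliffordAlgebra.contractLeft (Dual.eval ℝ _ u ∘ₗ LinearMap.fst ℝ _ _)

/-- Contraction of the last internal index with an element of the dual of `V_x`. -/
def contractInternal {x : S} (d : Dual ℝ (V x)) : FormFibre E V x →ₗ[ℝ] FormFibre E V x :=
  CliffordAlgebra.contractRight.flip (d ∘ₗ LinearMap.snd ℝ _ _)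

/-- The value `α(u, w) ∈ V_x` of `α ∈ Λ²T_x^*S ⊗ V_x`. -/
def eval21 {x : S} (α : FormFibre E V x) (u w : TangentSpace 𝓘(ℝ, E) x) : V x :=
  vecPart E V x (insertVec w (insertVec u α))

end Basic

section Bundle

variable (E : Type*) [NormedAddCommGroup E] [NormedSpace ℝ E]
  {S : Type*} [TopologicalSpace S] [ChartedSpace E S] [IsManifold 𝓘(ℝ, E) ∞ S]
  (F : Type*) [NormedAddCommGroup F] [NormedSpace ℝ F]
  (V : S → Type*) [TopologicalSpace (TotalSpace F V)]
  [∀ x, AddCommGroup (V x)] [∀ x, Module ℝ (V x)] [∀ x, TopologicalSpace (V x)]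
  [∀ x, IsTopologicalAddGroup (V x)] [∀ x, ContinuousSMul ℝ (V x)]
  [FiberBundle F V] [VectorBundle ℝ F V]

/-- The identification of `T_x^*S ⊕ V_x`, for `x` near `x₀`, with `E^* ⊕ F` given by the preferred
trivializations of `TS` and `V` at `x₀`. -/
def coordMap (x₀ x : S) :
    (Dual ℝ (TangentSpace 𝓘(ℝ, E) x) × V x) →ₗ[ℝ] (Dual ℝ E × F) :=
  LinearMap.prodMap
    (((trivializationAt E (TangentSpace 𝓘(ℝ, E) : S → Type _) x₀).symmₗ ℝ x).dualMap)
    ((trivializationAt F V x₀).linearMapAt ℝ x)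

/-- Smoothness: near every point all components in local trivializations are smooth functions. -/
def IsSmoothField (α : FormField E V) : Prop :=
  ∀ (x₀ : S) (l : Dual ℝ (ExteriorAlgebra ℝ (Dual ℝ E × F))),
    ContMDiffAt 𝓘(ℝ, E) 𝓘(ℝ, ℝ) ∞
      (fun x ↦ l (ExteriorAlgebra.map (coordMap E F V x₀ x) (α x))) x₀

/-- `Ω_∂^{i,j} = Ω^i(S, Λ^j V)`: the smooth `i`-forms on `S` with values in `Λ^j V`. -/
def Omega (i j : ℕ) : Submodule ℝ (FormField E V) where
  carrier := {α | (∀ x, α x ∈ bidegree E V i j x) ∧ IsSmoothField E F V α}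
  add_mem' := by
    rintro α β ⟨ha, hsa⟩ ⟨hb, hsb⟩
    refine ⟨fun x ↦ Submodule.add_mem _ (ha x) (hb x), fun x₀ l ↦ ?_⟩
    simp only [Pi.add_apply, map_add]
    exact (hsa x₀ l).add (hsb x₀ l)
  zero_mem' := by
    refine ⟨fun x ↦ Submodule.zero_mem _, fun x₀ l ↦ ?_⟩
    simpa using contMDiffAt_const
  smul_mem' := by
    rintro c α ⟨ha, hsa⟩
    refine ⟨fun x ↦ Submodule.smul_mem _ c (ha x), fun x₀ l ↦ ?_⟩
    simp only [Pi.smul_apply, map_smul]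
    have hc : ContMDiffAt 𝓘(ℝ, E) 𝓘(ℝ, ℝ) ∞ (fun _ : S ↦ c) x₀ := contMDiffAt_const
    exact hc.smul (hsa x₀ l)

/-- A smooth fibre metric on `V` of Lorentzian signature `(-, +, …, +)`. -/
structure LorentzMetric where
  inner (x : S) : V x →L[ℝ] V x →L[ℝ] ℝ
  symm (x : S) (s t : V x) : inner x s t = inner x t s
  lorentzian (x : S) : ∃ t : V x, inner x t t < 0 ∧
    ∀ s : V x, inner x t s = 0 → s ≠ 0 → 0 < inner x s s
  contMDiff : ContMDiff 𝓘(ℝ, E) (𝓘(ℝ, E).prod 𝓘(ℝ, F →L[ℝ] F →L[ℝ] ℝ)) ∞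
    (fun x ↦ TotalSpace.mk' (F →L[ℝ] F →L[ℝ] ℝ) (E := fun x ↦ V x →L[ℝ] V x →L[ℝ] ℝ) x (inner x))

/-- A boundary coframe: a smooth, fibrewise injective bundle map `e : TS → V`. -/
structure BoundaryCoframe where
  toFun (x : S) : TangentSpace 𝓘(ℝ, E) x →L[ℝ] V x
  injective (x : S) : Function.Injective (toFun x)
  contMDiff : ContMDiff 𝓘(ℝ, E) (𝓘(ℝ, E).prod 𝓘(ℝ, E →L[ℝ] F)) ∞
    (fun x ↦ TotalSpace.mk' (E →L[ℝ] F)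
      (E := fun x ↦ TangentSpace 𝓘(ℝ, E) x →L[ℝ] V x) x (toFun x))

/-- A smooth section of `V` which is transversal to `e(TS)` at every point. -/
structure TransversalSection (e : BoundaryCoframe E F V) where
  toFun (x : S) : V x
  transversal (x : S) : toFun x ∉ Set.range (e.toFun x)
  contMDiff : ContMDiff 𝓘(ℝ, E) (𝓘(ℝ, E).prod 𝓘(ℝ, F)) ∞ (fun x ↦ TotalSpace.mk' F x (toFun x))

variable {E F V}

/-- The induced boundary metric `g^∂ = e^*η`. -/
def boundaryMetric (η : LorentzMetric E F V) (e : BoundaryCoframe E F V) (x : S)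
    (u w : TangentSpace 𝓘(ℝ, E) x) : ℝ :=
  η.inner x (e.toFun x u) (e.toFun x w)

/-- The boundary metric is degenerate (light-like) at every point. -/
def IsDegenerate (η : LorentzMetric E F V) (e : BoundaryCoframe E F V) : Prop :=
  ∀ x : S, ∃ u : TangentSpace 𝓘(ℝ, E) x, u ≠ 0 ∧ ∀ w, boundaryMetric η e x u w = 0

/-- The functional `η(s, ·)` on `V_x`. -/
def flat (η : LorentzMetric E F V) {x : S} (s : V x) : Dual ℝ (V x) :=
  (η.inner x s : V x →ₗ[ℝ] ℝ)

/-- The value at `s ∈ V_x` of the endomorphism `A(u) ∈ Λ²V_x ≅ 𝔰𝔬(V_x, η)`, where `A` has bidegree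
`(1, 2)`; here `a ∧ b` acts by `s ↦ a η(b, s) - b η(a, s)`. -/
def act (η : LorentzMetric E F V) {x : S} (A : FormFibre E V x)
    (u : TangentSpace 𝓘(ℝ, E) x) (s : V x) : V x :=
  vecPart E V x (contractInternal (flat η s) (insertVec u A))

section FiniteDim

variable [FiniteDimensional ℝ E]

/-- A basis of the tangent space; the definitions below do not depend on it. -/
def tangentBasis (x : S) : Basis (Fin (finrank ℝ E)) ℝ (TangentSpace 𝓘(ℝ, E) x) :=
  finBasis ℝ E

/-- The coframe as a field of bidegree `(1, 1)`: `e = ∑_μ dx^μ e_μ`. -/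
def coframeForm (e : BoundaryCoframe E F V) : FormField E V := fun x ↦
  ∑ μ, covec E V x ((tangentBasis x).coord μ) * vec E V x (e.toFun x (tangentBasis x μ))

/-- The map `X ↦ X ∧ e ∧ ⋯ ∧ e` (`k` factors `e`). -/
def wedgePow (e : BoundaryCoframe E F V) (k : ℕ) : FormField E V →ₗ[ℝ] FormField E V :=
  LinearMap.mulRight ℝ (coframeForm e ^ k)

/-- `Ker W_k^{∂,(i,j)}`. -/
def kerW (e : BoundaryCoframe E F V) (k i j : ℕ) : Submodule ℝ (FormField E V) :=
  Omega E F V i j ⊓ LinearMap.ker (wedgePow e k)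

/-- `Im W_k^{∂,(i,j)}`. -/
def imW (e : BoundaryCoframe E F V) (k i j : ℕ) : Submodule ℝ (FormField E V) :=
  (Omega E F V i j).map (wedgePow e k)

/-- `ϱ^{(1,2)} : X ↦ [X, e]`, in components
`[X, e]_{μν}^a = X_μ^{ab} η_{bc} e_ν^c - X_ν^{ab} η_{bc} e_μ^c`. -/
def rho (η : LorentzMetric E F V) (e : BoundaryCoframe E F V) :
    FormField E V →ₗ[ℝ] FormField E V where
  toFun X := fun x ↦ -∑ ν, covec E V x ((tangentBasis x).coord ν) *
    contractInternal (flat η (e.toFun x (tangentBasis x ν))) (X x)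
  map_add' X Y := by
    funext x
    simp only [Pi.add_apply, map_add, mul_add, Finset.sum_add_distrib, neg_add]
  map_smul' c X := by
    funext x
    simp only [Pi.smul_apply, map_smul, mul_smul_comm, ← Finset.smul_sum, smul_neg,
      RingHom.id_apply]

/-- `Im ϱ^{(1,2)}|_{Ker W_{N-3}^{∂,(1,2)}}`. -/
def imRho (η : LorentzMetric E F V) (e : BoundaryCoframe E F V) (N : ℕ) :
    Submodule ℝ (FormField E V) :=
  (kerW e (N - 3) 1 2).map (rho η e)

/-- `J` is a complement of `Im ϱ^{(1,2)}|_{Ker W_{N-3}^{∂,(1,2)}}` in `Ω_∂^{2,1}`. -/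
def IsComplement (η : LorentzMetric E F V) (e : BoundaryCoframe E F V) (N : ℕ)
    (J : Submodule ℝ (FormField E V)) : Prop :=
  imRho η e N ⊓ J = ⊥ ∧ imRho η e N ⊔ J = Omega E F V 2 1

/-- `𝒯 = Ker W_{N-3}^{∂,(2,1)} ∩ J`. -/
def spaceT (e : BoundaryCoframe E F V) (N : ℕ) (J : Submodule ℝ (FormField E V)) :
    Submodule ℝ (FormField E V) :=
  kerW e (N - 3) 2 1 ⊓ J

/-- `𝒦 = Ker W_{N-3}^{∂,(1,2)} ∩ Ker ϱ^{(1,2)}`. -/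
def spaceK (η : LorentzMetric E F V) (e : BoundaryCoframe E F V) (N : ℕ) :
    Submodule ℝ (FormField E V) :=
  kerW e (N - 3) 1 2 ⊓ LinearMap.ker (rho η e)

/-- The restriction of the linear map `p` to `D` is a projection of `D` onto `T`. -/
def IsProjection (D T : Submodule ℝ (FormField E V)) (p : FormField E V →ₗ[ℝ] FormField E V) :
    Prop :=
  T ≤ D ∧ (∀ α ∈ D, p α ∈ T) ∧ ∀ α ∈ T, p α = α

end FiniteDim

section Riemannian

/-- The fibre metric `G` on `V` extends the Riemannian metric `h` on `S` along the decomposition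
`V = e(TS) ⊕ ℝ e_n`: the map `e` is isometric and `e_n` is orthogonal to `e(TS)`. -/
def ExtendsMetric (e : BoundaryCoframe E F V) (en : TransversalSection E F V e)
    (h : ContMDiffRiemannianMetric 𝓘(ℝ, E) ∞ E (TangentSpace 𝓘(ℝ, E) : S → Type _))
    (G : ContMDiffRiemannianMetric 𝓘(ℝ, E) ∞ F V) : Prop :=
  ∀ (x : S) (u : TangentSpace 𝓘(ℝ, E) x),
    G.inner x (en.toFun x) (e.toFun x u) = 0 ∧
      ∀ w, G.inner x (e.toFun x u) (e.toFun x w) = h.inner x u w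

/-- Pointwise orthogonality in `Λ²T^*S ⊗ V` with respect to the metric induced by `h` and `G`. -/
def Orthogonal21
    (h : ContMDiffRiemannianMetric 𝓘(ℝ, E) ∞ E (TangentSpace 𝓘(ℝ, E) : S → Type _))
    (G : ContMDiffRiemannianMetric 𝓘(ℝ, E) ∞ F V) (α β : FormField E V) : Prop :=
  ∀ (x : S) (b : Basis (Fin (finrank ℝ E)) ℝ (TangentSpace 𝓘(ℝ, E) x)),
    (∀ i j, h.inner x (b i) (b j) = if i = j then 1 else 0) →
      ∑ i, ∑ j, G.inner x (eval21 (α x) (b i) (b j)) (eval21 (β x) (b i) (b j)) = 0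

/-- `p` restricts to the orthogonal projection of `Ω_∂^{2,1}` onto `T`. -/
def IsOrthogonalProjection21
    (h : ContMDiffRiemannianMetric 𝓘(ℝ, E) ∞ E (TangentSpace 𝓘(ℝ, E) : S → Type _))
    (G : ContMDiffRiemannianMetric 𝓘(ℝ, E) ∞ F V) (T : Submodule ℝ (FormField E V))
    (p : FormField E V →ₗ[ℝ] FormField E V) : Prop :=
  IsProjection (Omega E F V 2 1) T p ∧
    ∀ α ∈ Omega E F V 2 1, ∀ θ ∈ T, Orthogonal21 h G (α - p α) θ

end Riemannian

section Connection

/-- The connection is compatible with `η`: `d(η(σ, τ)) = η(∇σ, τ) + η(σ, ∇τ)`. -/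
def IsMetricConnection (η : LorentzMetric E F V)
    (ω₀ : CovariantDerivative 𝓘(ℝ, E) F V) : Prop :=
  ∀ (x : S) (u : TangentSpace 𝓘(ℝ, E) x) (σ τ : (y : S) → V y),
    MDifferentiableAt 𝓘(ℝ, E) (𝓘(ℝ, E).prod 𝓘(ℝ, F)) (fun y ↦ TotalSpace.mk' F y (σ y)) x →
    MDifferentiableAt 𝓘(ℝ, E) (𝓘(ℝ, E).prod 𝓘(ℝ, F)) (fun y ↦ TotalSpace.mk' F y (τ y)) x →
      mvfderiv 𝓘(ℝ, E) (fun y ↦ η.inner y (σ y) (τ y)) x u =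
        η.inner x (ω₀ σ x u) (τ x) + η.inner x (σ x) (ω₀ τ x u)

/-- The covariant derivative `(∇^ω_u σ)(x)` of the connection `ω = ω₀ + A`, for `A` of bidegree
`(1, 2)`. -/
def covDeriv (η : LorentzMetric E F V) (ω₀ : CovariantDerivative 𝓘(ℝ, E) F V)
    (A : FormField E V) (σ : (y : S) → V y) (x : S) (u : TangentSpace 𝓘(ℝ, E) x) : V x :=
  ω₀ σ x u + act η (A x) u (σ x)

/-- `(d_ω e)(u, w)` for `ω = ω₀ + A`, computed as `∇^ω_X (e Y) - ∇^ω_Y (e X) - e [X, Y]` at `x`, for vector fields `X`, `Y` which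
extend `u`, `w`. -/
def torsionValue (η : LorentzMetric E F V) (e : BoundaryCoframe E F V)
    (ω₀ : CovariantDerivative 𝓘(ℝ, E) F V) (A : FormField E V) (x : S)
    (u w : TangentSpace 𝓘(ℝ, E) x) : V x :=
  covDeriv η ω₀ A (fun y ↦ e.toFun y (FiberBundle.extend E w y)) x u
    - covDeriv η ω₀ A (fun y ↦ e.toFun y (FiberBundle.extend E u y)) x w
    - e.toFun x (VectorField.mlieBracket 𝓘(ℝ, E)
        (FiberBundle.extend E u) (FiberBundle.extend E w) x)

/-- `d_ω e`, for the connection `ω = ω₀ + A`, as a field of bidegree `(2, 1)`: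
`d_ω e = (1/2) ∑_{μ,ν} dx^μ dx^ν (d_ω e)(∂_μ, ∂_ν)`. -/
def dCoframe [FiniteDimensional ℝ E] (η : LorentzMetric E F V) (e : BoundaryCoframe E F V)
    (ω₀ : CovariantDerivative 𝓘(ℝ, E) F V) (A : FormField E V) : FormField E V := fun x ↦
  (1 / 2 : ℝ) • ∑ μ, ∑ ν, covec E V x ((tangentBasis x).coord μ) *
    covec E V x ((tangentBasis x).coord ν) *
      vec E V x (torsionValue η e ω₀ A x (tangentBasis x μ) (tangentBasis x ν))

end Connection

/-- The section `e_n` as a field of bidegree `(0, 1)`. -/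
def transversalForm {e : BoundaryCoframe E F V} (en : TransversalSection E F V e) :
    FormField E V := fun x ↦ vec E V x (en.toFun x)

end Bundle

end PalatiniCartan

end

/-! Put m = N − 1, the rank of TΣ. Fibrewise, multiplication by e and the trace Λ = ∑ ι_{∂_μ}
ι_{e^μ} behave like the Lefschetz pair of Kähler geometry: on elements of total degree d without e_n
component, [Λ, e] = m − d (`tr_cof_mul`, `count_add`). Hence on trace-free elements of this kind e^k
is injective if k + d ≤ m and zero if k + d > m (`eq_zero_of_cof_pow_mul`, `cof_pow_mul_eq_zero`).

In bidegree (2,1) this identifies Ker e^{m-2} with the forms that have no e_n component and no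
trace. It has three consequences. Every form of bidegree (2,1) is an element of that kernel plus
some Z = eα + βe_n (`exists_smooth_decomposition`). Such Z are orthogonal to the kernel for the
metric induced by h, so p_𝒯 Z = 0 (`proj_eq_zero`). An element Y of the kernel vanishes as soon as
e_n e^{m-3} Y lies in Im e^{m-2} (`eq_zero_of_mem_imW`). Moreover ϱ maps Ker e^{m-2} in bidegree
(1,2) to Ker e^{m-2} in bidegree (2,1), because g^∂ is symmetric (`rho_mem_kerW`).

Subtracting v from ω̃ changes the torsion by −ϱ(v). For existence, split the torsion of ω̃ into a
kernel part and Z, and split the kernel part as ϱ(v) + t along J; then t ∈ 𝒯. Passing from ω̃ to ω̃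
− v leaves the torsion t + Z, and the structural expression becomes e_n e^{m-3} Z = e_n e^{m-2} α,
which is in the image. Subtracting p_𝒦 v from v does not affect ϱ(v). For uniqueness, the difference
u of two solutions satisfies ϱ(u) = p_𝒯 ϱ(u), so ϱ(u) lies in Im ϱ ∩ J = 0; thus u ∈ 𝒦 and u = p_𝒦 u
= 0 (`eq_of_structural_constraint`). -/

noncomputable section

namespace PalatiniCartan

/-! ### Contractions and the coframe in the exterior algebra of T^* ⊕ W -/

section Algebra

/-- The algebra `Λ(T^* ⊕ W)`. -/
abbrev Ext (T W : Type*) [AddCommGroup T] [Module ℝ T] [AddCommGroup W] [Module ℝ W] : Type _ :=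
  ExteriorAlgebra ℝ (Dual ℝ T × W)

variable {T W : Type*} [AddCommGroup T] [Module ℝ T] [AddCommGroup W] [Module ℝ W]

variable (T W) in
/-- Covectors as elements of degree one. -/
def cv : Dual ℝ T →ₗ[ℝ] Ext T W := ExteriorAlgebra.ι ℝ ∘ₗ LinearMap.inl ℝ _ _

variable (T W) in
/-- Vectors as elements of degree one. -/
def vc : W →ₗ[ℝ] Ext T W := ExteriorAlgebra.ι ℝ ∘ₗ LinearMap.inr ℝ _ _

variable (W) in
/-- Interior product with a vector of `T`. -/
def ins : T →ₗ[ℝ] Ext T W →ₗ[ℝ] Ext T W :=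
  CliffordAlgebra.contractLeft ∘ₗ LinearMap.lcomp ℝ ℝ (LinearMap.fst ℝ (Dual ℝ T) W) ∘ₗ
    Dual.eval ℝ T

variable (T) in
/-- Left contraction with a covector of `W`. -/
def cin : Dual ℝ W →ₗ[ℝ] Ext T W →ₗ[ℝ] Ext T W :=
  CliffordAlgebra.contractLeft ∘ₗ LinearMap.lcomp ℝ ℝ (LinearMap.snd ℝ (Dual ℝ T) W)

theorem ins_cv_mul (u : T) (ξ : Dual ℝ T) (X : Ext T W) :
    ins W u (cv T W ξ * X) = ξ u • X - cv T W ξ * ins W u X :=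
  CliffordAlgebra.contractLeft_ι_mul _ _ _

theorem ins_vc_mul (u : T) (w : W) (X : Ext T W) :
    ins W u (vc T W w * X) = -(vc T W w * ins W u X) := by
  refine (CliffordAlgebra.contractLeft_ι_mul _ _ _).trans ?_
  simp [ins, vc]

theorem cin_cv_mul (d : Dual ℝ W) (ξ : Dual ℝ T) (X : Ext T W) :
    cin T d (cv T W ξ * X) = -(cv T W ξ * cin T d X) := by
  refine (CliffordAlgebra.contractLeft_ι_mul _ _ _).trans ?_
  simp [cin, cv]

theorem cin_vc_mul (d : Dual ℝ W) (w : W) (X : Ext T W) :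
    cin T d (vc T W w * X) = d w • X - vc T W w * cin T d X :=
  CliffordAlgebra.contractLeft_ι_mul _ _ _

theorem cin_self (d : Dual ℝ W) (X : Ext T W) : cin T d (cin T d X) = 0 :=
  CliffordAlgebra.contractLeft_contractLeft _ _

theorem cin_ins (d : Dual ℝ W) (u : T) (X : Ext T W) :
    cin T d (ins W u X) = -ins W u (cin T d X) :=
  CliffordAlgebra.contractLeft_comm _ _ _

theorem ins_ins (u u' : T) (X : Ext T W) :
    ins W u (ins W u' X) = -ins W u' (ins W u X) :=
  CliffordAlgebra.contractLeft_comm _ _ _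

@[simp] theorem ins_one (u : T) : ins W u (1 : Ext T W) = 0 :=
  CliffordAlgebra.contractLeft_one (Q := 0) _

@[simp] theorem cin_one (d : Dual ℝ W) : cin T d (1 : Ext T W) = 0 :=
  CliffordAlgebra.contractLeft_one (Q := 0) _

theorem ι_mul_ι_swap {M : Type*} [AddCommGroup M] [Module ℝ M] (a b : M) :
    ExteriorAlgebra.ι ℝ a * ExteriorAlgebra.ι ℝ b
      = -(ExteriorAlgebra.ι ℝ b * ExteriorAlgebra.ι ℝ a) :=
  eq_neg_of_add_eq_zero_left (ExteriorAlgebra.ι_add_mul_swap a b)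

theorem cv_mul_cv (a b : Dual ℝ T) : cv T W a * cv T W b = -(cv T W b * cv T W a) :=
  ι_mul_ι_swap _ _

theorem vc_mul_vc (a b : W) : vc T W a * vc T W b = -(vc T W b * vc T W a) :=
  ι_mul_ι_swap _ _

theorem cv_mul_vc (a : Dual ℝ T) (b : W) : cv T W a * vc T W b = -(vc T W b * cv T W a) :=
  ι_mul_ι_swap _ _

@[simp] theorem vc_mul_self (a : W) : vc T W a * vc T W a = 0 := ExteriorAlgebra.ι_sq_zero _

theorem commute_ι_mul_ι {M : Type*} [AddCommGroup M] [Module ℝ M] (a b : M)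
    (X : ExteriorAlgebra ℝ M) :
    Commute (ExteriorAlgebra.ι ℝ a * ExteriorAlgebra.ι ℝ b) X := by
  induction X using ExteriorAlgebra.induction with
  | algebraMap r => exact (Algebra.commutes r _).symm
  | ι c =>
    change _ * _ * _ = _ * (_ * _)
    rw [mul_assoc, ι_mul_ι_swap b c, mul_neg, ← mul_assoc, ι_mul_ι_swap a c, neg_mul, neg_neg,
      mul_assoc]
  | mul x y hx hy => exact hx.mul_right hy
  | add x y hx hy => exact hx.add_right hy

variable {κ : Type*} [Fintype κ] (b : Basis κ ℝ T) (e : T →ₗ[ℝ] W)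

/-- The form `∑ dx^μ e_μ`. -/
def cof : Ext T W := ∑ μ, cv T W (b.coord μ) * vc T W (e (b μ))

theorem commute_cof (X : Ext T W) : Commute (cof b e) X :=
  Commute.sum_left _ _ _ fun _ _ ↦ commute_ι_mul_ι _ _ _

theorem commute_cof_pow (k : ℕ) (X : Ext T W) : Commute (cof b e ^ k) X :=
  (commute_cof b e X).pow_left k

/-- The coframe is a sum of commuting elements of square zero. -/
theorem isNilpotent_cof : IsNilpotent (cof b e) := by
  refine Commute.isNilpotent_sum (fun μ _ ↦ ⟨2, ?_⟩) fun _ _ _ _ ↦ commute_ι_mul_ι _ _ _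
  rw [sq, mul_assoc, ← mul_assoc (vc T W _), ← neg_eq_iff_eq_neg.mpr (cv_mul_vc _ _)]
  simp [mul_assoc]

theorem cv_eq_sum (ξ : Dual ℝ T) : cv T W ξ = ∑ μ, ξ (b μ) • cv T W (b.coord μ) := by
  simp_rw [← map_smul, ← map_sum]
  rw [b.sum_dual_apply_smul_coord]

theorem vc_eq_sum (u : T) : vc T W (e u) = ∑ μ, b.coord μ u • vc T W (e (b μ)) := by
  simp_rw [← map_smul, ← map_sum, Basis.coord_apply]
  rw [b.sum_repr]

theorem ins_cof_mul (u : T) (X : Ext T W) :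
    ins W u (cof b e * X) = vc T W (e u) * X + cof b e * ins W u X := by
  rw [vc_eq_sum b e u]
  simp only [cof, Finset.sum_mul, map_sum, mul_assoc, ins_cv_mul, ins_vc_mul, mul_neg,
    sub_neg_eq_add, Finset.sum_add_distrib, smul_mul_assoc]

theorem cin_cof_mul (d : Dual ℝ W) (X : Ext T W) :
    cin T d (cof b e * X) = -(cv T W (d ∘ₗ e) * X) + cof b e * cin T d X := by
  rw [cv_eq_sum b (d ∘ₗ e)]
  simp only [cof, LinearMap.comp_apply, Finset.sum_mul, map_sum, mul_assoc, cin_cv_mul,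
    cin_vc_mul, mul_sub,
    neg_sub, Finset.sum_sub_distrib, smul_mul_assoc, mul_smul_comm]
  abel

/-- A covector that vanishes on e(T) annihilates e, and e has even degree, so no sign appears.
Applied to the coordinate along n, this extracts n-components from equations that contain powers of
e. -/
theorem cin_cof_pow_mul {d : Dual ℝ W} (hd : d ∘ₗ e = 0) (k : ℕ) (X : Ext T W) :
    cin T d (cof b e ^ k * X) = cof b e ^ k * cin T d X := by
  induction k with
  | zero => simp
  | succ k ih => rw [pow_succ', mul_assoc, cin_cof_mul, hd, ih, mul_assoc]; simp

variable (r : W →ₗ[ℝ] T)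

/-- The trace `∑ ι_{∂_μ} ι_{e^μ}`, where `e^μ = dx^μ ∘ r`. -/
def tr : Ext T W →ₗ[ℝ] Ext T W := ∑ μ, cin T (b.coord μ ∘ₗ r) ∘ₗ ins W (b μ)

/-- The operator which counts the factors in `T^*` and in `range e`. -/
def count : Ext T W →ₗ[ℝ] Ext T W :=
  ∑ μ, (LinearMap.mulLeft ℝ (vc T W (e (b μ))) ∘ₗ cin T (b.coord μ ∘ₗ r) +
    LinearMap.mulLeft ℝ (cv T W (b.coord μ)) ∘ₗ ins W (b μ))

theorem tr_apply (X : Ext T W) : tr b r X = ∑ μ, cin T (b.coord μ ∘ₗ r) (ins W (b μ) X) := by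
  simp [tr]

theorem count_apply (X : Ext T W) : count b e r X = ∑ μ, (vc T W (e (b μ)) *
    cin T (b.coord μ ∘ₗ r) X + cv T W (b.coord μ) * ins W (b μ) X) := by
  simp [count]

variable {b e r}

/-- The Lefschetz commutator [Λ, e] = m − (counting operator): the two contractions either both hit
e, giving m, or exactly one does, giving one of the two halves of `count`. -/
theorem tr_cof_mul (hr : ∀ u, r (e u) = u) (X : Ext T W) :
    tr b r (cof b e * X) =
      cof b e * tr b r X + (Fintype.card κ : ℝ) • X - count b e r X := by
  have h (μ) : (b.coord μ ∘ₗ r) ∘ₗ e = b.coord μ := by ext u; simp [hr]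
  simp only [tr_apply, count_apply, ins_cof_mul, map_add, cin_vc_mul, cin_cof_mul, h]
  simp [hr, Finset.sum_add_distrib, Finset.mul_sum, Finset.sum_sub_distrib, Nat.cast_smul_eq_nsmul]
  abel

variable {n : W} {lam : Dual ℝ W}

/-- The operator on the left is a derivation and is the identity on generators, since e ∘ r + n ⊗
lam = 1; so it is the Euler operator of the exterior algebra. -/
theorem count_add {k : ℕ} (hn : ∀ w, e (r w) + lam w • n = w) {X : Ext T W}
    (hX : X ∈ LinearMap.range (ExteriorAlgebra.ι ℝ (M := Dual ℝ T × W)) ^ k) :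
    count b e r X + vc T W n * cin T lam X = (k : ℝ) • X := by
  induction k generalizing X with
  | zero =>
    obtain ⟨c, rfl⟩ := Submodule.mem_one.mp (by simpa using hX)
    simp [count_apply, Algebra.algebraMap_eq_smul_one]
  | succ k ih =>
    rw [pow_succ'] at hX
    induction hX using Submodule.mul_induction_on' with
    | add x _ y _ hx hy => rw [smul_add, ← hx, ← hy, map_add, map_add, mul_add]; abel
    | mem_mul_mem x hx Y hY =>
      obtain ⟨⟨ξ, w⟩, rfl⟩ := hx
      have hs : ExteriorAlgebra.ι ℝ (ξ, w) = cv T W ξ + vc T W w := by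
        simp [cv, vc, ← map_add]
      have key : ∀ Y : Ext T W, count b e r ((cv T W ξ + vc T W w) * Y) +
          vc T W n * cin T lam ((cv T W ξ + vc T W w) * Y) =
          (cv T W ξ + vc T W w) * Y +
          (cv T W ξ + vc T W w) * (count b e r Y + vc T W n * cin T lam Y) := by
        intro Y
        have h1 := cv_eq_sum (W := W) b ξ
        have h2 : vc T W w = (∑ μ, b.coord μ (r w) • vc T W (e (b μ))) + lam w • vc T W n := by
          conv_lhs => rw [← hn w]
          rw [map_add, vc_eq_sum b e (r w), map_smul]
        have e1 : ∀ μ, vc T W (e (b μ)) * cin T (b.coord μ ∘ₗ r) ((cv T W ξ + vc T W w) * Y) +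
            cv T W (b.coord μ) * ins W (b μ) ((cv T W ξ + vc T W w) * Y) =
            (ξ (b μ) • cv T W (b.coord μ) + b.coord μ (r w) • vc T W (e (b μ))) * Y +
            (cv T W ξ + vc T W w) * (vc T W (e (b μ)) * cin T (b.coord μ ∘ₗ r) Y +
              cv T W (b.coord μ) * ins W (b μ) Y) := by
          intro μ
          simp only [add_mul, map_add, cin_cv_mul, cin_vc_mul, ins_cv_mul, ins_vc_mul, mul_add,
            mul_sub, mul_neg, ← mul_assoc, cv_mul_vc ξ, vc_mul_vc w, cv_mul_cv ξ,
            cv_mul_vc _ w, mul_smul_comm, smul_mul_assoc, neg_mul, LinearMap.comp_apply]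
          abel
        have e2 : vc T W n * cin T lam ((cv T W ξ + vc T W w) * Y) =
            (lam w • vc T W n) * Y + (cv T W ξ + vc T W w) * (vc T W n * cin T lam Y) := by
          simp only [add_mul, map_add, cin_cv_mul, cin_vc_mul, mul_add,
            mul_sub, mul_neg, ← mul_assoc, cv_mul_vc ξ, vc_mul_vc w, mul_smul_comm,
            smul_mul_assoc, neg_mul]
          abel
        rw [e2, count_apply, Finset.sum_congr rfl fun μ _ ↦ e1 μ, Finset.sum_add_distrib,
          ← Finset.sum_mul, ← Finset.mul_sum, ← count_apply, Finset.sum_add_distrib, ← h1, mul_add,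
          add_add_add_comm, ← add_mul, add_assoc, ← h2]
      rw [hs, key, ih hY, mul_smul_comm]
      push_cast
      rw [add_smul, one_smul, add_comm]

end Algebra

/-! ### Lefschetz theory for powers of the coframe -/

section Lefschetz

variable {T W : Type*} [AddCommGroup T] [Module ℝ T] [AddCommGroup W] [Module ℝ W]

variable (T W) in
/-- The elements of degree `k`. -/
abbrev totalDegree (k : ℕ) : Submodule ℝ (Ext T W) :=
  LinearMap.range (ExteriorAlgebra.ι ℝ (M := Dual ℝ T × W)) ^ k

variable (T W) in
/-- The elements of bidegree `(i, j)`. -/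
abbrev bideg (i j : ℕ) : Submodule ℝ (Ext T W) :=
  LinearMap.range (cv T W) ^ i * LinearMap.range (vc T W) ^ j

theorem cv_mem_totalDegree (ξ : Dual ℝ T) : cv T W ξ ∈ totalDegree T W 1 := by
  rw [totalDegree, pow_one]; exact ⟨_, rfl⟩

theorem mul_mem_totalDegree {k l : ℕ} {X Y : Ext T W} (hX : X ∈ totalDegree T W k)
    (hY : Y ∈ totalDegree T W l) : X * Y ∈ totalDegree T W (k + l) := by
  rw [totalDegree, pow_add]; exact Submodule.mul_mem_mul hX hY

theorem bideg_le_totalDegree (i j : ℕ) : bideg T W i j ≤ totalDegree T W (i + j) := by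
  have hc : LinearMap.range (cv T W) ≤ LinearMap.range (ExteriorAlgebra.ι ℝ) :=
    LinearMap.range_comp_le_range _ _
  have hv : LinearMap.range (vc T W) ≤ LinearMap.range (ExteriorAlgebra.ι ℝ) :=
    LinearMap.range_comp_le_range _ _
  rw [totalDegree, pow_add]
  exact mul_le_mul' (pow_le_pow_left' hc _) (pow_le_pow_left' hv _)

theorem bideg_mul_le (i j k l : ℕ) :
    bideg T W i j * bideg T W k l ≤ bideg T W (i + k) (j + l) := by
  have h : LinearMap.range (vc T W) * LinearMap.range (cv T W) ≤
      LinearMap.range (cv T W) * LinearMap.range (vc T W) := by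
    rw [Submodule.mul_le]
    rintro _ ⟨w, rfl⟩ _ ⟨ξ, rfl⟩
    rw [← neg_eq_iff_eq_neg.mpr (cv_mul_vc ξ w)]
    exact Submodule.neg_mem _ (Submodule.mul_mem_mul ⟨_, rfl⟩ ⟨_, rfl⟩)
  have h1 (k : ℕ) : LinearMap.range (vc T W) * LinearMap.range (cv T W) ^ k ≤
      LinearMap.range (cv T W) ^ k * LinearMap.range (vc T W) := by
    induction k with
    | zero => simp
    | succ k ih =>
      rw [pow_succ', ← mul_assoc]
      refine (mul_le_mul_left h _).trans ?_
      rw [mul_assoc, mul_assoc]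
      exact mul_le_mul_right ih _
  have h2 (j : ℕ) : LinearMap.range (vc T W) ^ j * LinearMap.range (cv T W) ^ k ≤
      LinearMap.range (cv T W) ^ k * LinearMap.range (vc T W) ^ j := by
    induction j with
    | zero => simp
    | succ j ih =>
      rw [pow_succ, mul_assoc]
      refine (mul_le_mul_right (h1 k) _).trans ?_
      rw [← mul_assoc, ← mul_assoc]
      exact mul_le_mul_left ih _
  rw [bideg, bideg, bideg, pow_add, pow_add, mul_assoc, mul_assoc]
  refine mul_le_mul_right ?_ _
  rw [← mul_assoc, ← mul_assoc]
  exact mul_le_mul_left (h2 j) _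

theorem mul_mem_bideg {i j k l : ℕ} {X Y : Ext T W} (hX : X ∈ bideg T W i j)
    (hY : Y ∈ bideg T W k l) : X * Y ∈ bideg T W (i + k) (j + l) :=
  bideg_mul_le _ _ _ _ (Submodule.mul_mem_mul hX hY)

theorem cv_mem_bideg (ξ : Dual ℝ T) : cv T W ξ ∈ bideg T W 1 0 := by
  simp [bideg]

theorem vc_mem_bideg (w : W) : vc T W w ∈ bideg T W 0 1 := by
  simp [bideg]

theorem exists_cv_of_mem_bideg {X : Ext T W} (hX : X ∈ bideg T W 1 0) :
    ∃ ξ, cv T W ξ = X := by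
  simpa [bideg] using hX

/-- With the three lemmas that follow, this reduces linear identities in a fixed bidegree to
products of generators. -/
theorem bideg_two_zero_le {P : Submodule ℝ (Ext T W)}
    (h : ∀ ξ ξ', cv T W ξ * cv T W ξ' ∈ P) : bideg T W 2 0 ≤ P := by
  rw [bideg, pow_zero, mul_one, sq, Submodule.mul_le]
  rintro _ ⟨ξ, rfl⟩ _ ⟨ξ', rfl⟩
  exact h ξ ξ'

theorem bideg_one_one_le {P : Submodule ℝ (Ext T W)}
    (h : ∀ ξ w, cv T W ξ * vc T W w ∈ P) : bideg T W 1 1 ≤ P := by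
  rw [bideg, pow_one, pow_one, Submodule.mul_le]
  rintro _ ⟨ξ, rfl⟩ _ ⟨w, rfl⟩
  exact h ξ w

theorem bideg_two_one_le {P : Submodule ℝ (Ext T W)}
    (h : ∀ ξ ξ' w, cv T W ξ * cv T W ξ' * vc T W w ∈ P) : bideg T W 2 1 ≤ P := by
  rw [bideg, pow_one, sq, mul_assoc, Submodule.mul_le]
  rintro _ ⟨ξ, rfl⟩ Y hY
  induction hY using Submodule.mul_induction_on' with
  | add x _ y _ hx hy => rw [mul_add]; exact P.add_mem hx hy
  | mem_mul_mem x hx y hy =>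
    obtain ⟨ξ', rfl⟩ := hx
    obtain ⟨w, rfl⟩ := hy
    rw [← mul_assoc]
    exact h ξ ξ' w

theorem bideg_one_two_le {P : Submodule ℝ (Ext T W)}
    (h : ∀ ξ w w', cv T W ξ * (vc T W w * vc T W w') ∈ P) : bideg T W 1 2 ≤ P := by
  rw [bideg, pow_one, sq, Submodule.mul_le]
  rintro _ ⟨ξ, rfl⟩ Y hY
  induction hY using Submodule.mul_induction_on' with
  | add x _ y _ hx hy => rw [mul_add]; exact P.add_mem hx hy
  | mem_mul_mem x hx y hy =>
    obtain ⟨w, rfl⟩ := hx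
    obtain ⟨w', rfl⟩ := hy
    exact h ξ w w'

theorem cv_mul_comm {k : ℕ} {X : Ext T W} (hX : X ∈ totalDegree T W k) (ξ : Dual ℝ T) :
    cv T W ξ * X = (-1 : ℝ) ^ k • (X * cv T W ξ) := by
  induction k generalizing X with
  | zero =>
    obtain ⟨c, rfl⟩ := Submodule.mem_one.mp (by simpa using hX)
    simp [Algebra.commutes]
  | succ k ih =>
    rw [totalDegree, pow_succ'] at hX
    induction hX using Submodule.mul_induction_on' with
    | add x _ y _ hx hy => rw [mul_add, hx, hy, add_mul, smul_add]
    | mem_mul_mem x hx Y hY =>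
      obtain ⟨v, rfl⟩ := hx
      have h : cv T W ξ * ExteriorAlgebra.ι ℝ v = -(ExteriorAlgebra.ι ℝ v * cv T W ξ) :=
        ι_mul_ι_swap _ _
      rw [← mul_assoc, h, neg_mul, mul_assoc, ih hY, pow_succ]
      simp [mul_assoc]

variable {κ : Type*} [Fintype κ] {b : Basis κ ℝ T} {e : T →ₗ[ℝ] W} {n : W}

/-- A splitting `W = e(T) ⊕ ℝ n`: the projection to `T` and the coordinate along `n`. -/
structure Splitting (e : T →ₗ[ℝ] W) (n : W) where
  proj : W →ₗ[ℝ] T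
  coord : Dual ℝ W
  proj_apply (u : T) : proj (e u) = u
  coord_comp : coord ∘ₗ e = 0
  coord_self : coord n = 1
  decomp (w : W) : e (proj w) + coord w • n = w

theorem nonempty_splitting [FiniteDimensional ℝ T] [FiniteDimensional ℝ W]
    (he : Function.Injective e) (hn : n ∉ Set.range e) (hd : finrank ℝ T + 1 = finrank ℝ W) :
    Nonempty (Splitting e n) := by
  let f : T × ℝ →ₗ[ℝ] W := e.coprod (LinearMap.toSpanSingleton ℝ W n)
  have hf : Function.Injective f := by
    rw [← LinearMap.ker_eq_bot, LinearMap.ker_eq_bot']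
    rintro ⟨u, c⟩ h
    have h' : e u + c • n = 0 := by simpa [f] using h
    by_cases hc : c = 0
    · subst hc
      rw [zero_smul, add_zero] at h'
      rw [he (h'.trans (map_zero e).symm)]
      rfl
    · refine absurd ⟨-c⁻¹ • u, ?_⟩ hn
      rw [map_smul, eq_neg_of_add_eq_zero_left h', smul_neg, neg_smul, neg_neg, smul_smul,
        inv_mul_cancel₀ hc, one_smul]
  let F := LinearEquiv.ofInjectiveOfFinrankEq f hf (by simp [hd])
  have hF (p : T × ℝ) : F p = e p.1 + p.2 • n := rfl
  refine ⟨⟨LinearMap.fst ℝ T ℝ ∘ₗ F.symm.toLinearMap, LinearMap.snd ℝ T ℝ ∘ₗ F.symm.toLinearMap,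
    fun u ↦ ?_, ?_, ?_, fun w ↦ ?_⟩⟩
  · have : F.symm (e u) = (u, 0) := by rw [LinearEquiv.symm_apply_eq, hF]; simp
    simp [this]
  · ext u
    have : F.symm (e u) = (u, 0) := by rw [LinearEquiv.symm_apply_eq, hF]; simp
    simp [this]
  · have : F.symm n = (0, 1) := by rw [LinearEquiv.symm_apply_eq, hF]; simp
    simp [this]
  · exact (hF (F.symm w)).symm.trans (F.apply_symm_apply w)

variable (b e) in
theorem cof_mem_bideg : cof b e ∈ bideg T W 1 1 :=
  Submodule.sum_mem _ fun μ _ ↦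
    (mul_mem_bideg (cv_mem_bideg (b.coord μ)) (vc_mem_bideg (e (b μ))) :)

variable (b e) in
theorem cof_pow_mul_mem {d : ℕ} (k : ℕ) {X : Ext T W} (hX : X ∈ totalDegree T W d) :
    cof b e ^ k * X ∈ totalDegree T W (d + 2 * k) := by
  induction k with
  | zero => simpa using hX
  | succ k ih =>
    rw [pow_succ', mul_assoc, show d + 2 * (k + 1) = 1 + 1 + (d + 2 * k) by ring]
    exact mul_mem_totalDegree (bideg_le_totalDegree _ _ (cof_mem_bideg b e)) ih

variable (s : Splitting e n)

/-- Iterating the commutator sums the weights m − d − 2j over 0 ≤ j ≤ k, which gives (k + 1)(m − d −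
k). -/
theorem tr_cof_pow_mul {d : ℕ} {X : Ext T W} (hX : X ∈ totalDegree T W d)
    (h0 : cin T s.coord X = 0) (k : ℕ) :
    tr b s.proj (cof b e ^ (k + 1) * X) = cof b e ^ (k + 1) * tr b s.proj X +
      (((k : ℝ) + 1) * (Fintype.card κ - d - k)) • (cof b e ^ k * X) := by
  induction k with
  | zero =>
    have := count_add (b := b) s.decomp hX
    rw [h0, mul_zero, add_zero] at this
    rw [zero_add, pow_one, tr_cof_mul s.proj_apply, this, pow_zero, one_mul]
    push_cast
    module
  | succ k ih =>
    have h1 : cin T s.coord (cof b e ^ (k + 1) * X) = 0 := by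
      rw [cin_cof_pow_mul b e s.coord_comp, h0, mul_zero]
    have := count_add (b := b) s.decomp (cof_pow_mul_mem b e (k + 1) hX)
    rw [h1, mul_zero, add_zero] at this
    rw [pow_succ' _ (k + 1), mul_assoc, tr_cof_mul s.proj_apply, this, ih, mul_add, ← mul_assoc,
      mul_smul_comm, ← mul_assoc (cof b e), ← pow_succ' _ k, ← pow_succ' _ (k + 1)]
    push_cast
    module

/-- For trace-free X, applying the trace to e^{k+1} X = 0 returns a multiple of e^k X. In this range
the factor is positive, so one can descend to X itself. -/
theorem eq_zero_of_cof_pow_mul {d k : ℕ} {X : Ext T W} (hX : X ∈ totalDegree T W d)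
    (h0 : cin T s.coord X = 0) (ht : tr b s.proj X = 0) (hk : k + d ≤ Fintype.card κ)
    (h : cof b e ^ k * X = 0) : X = 0 := by
  induction k with
  | zero => simpa using h
  | succ k ih =>
    refine ih (by omega) ?_
    have := tr_cof_pow_mul (b := b) s hX h0 k
    rw [h, map_zero, ht, mul_zero, zero_add, eq_comm, smul_eq_zero] at this
    refine this.resolve_left (mul_ne_zero (by positivity) ?_)
    have : (k : ℝ) + 1 + d ≤ Fintype.card κ := by exact_mod_cast hk
    linarith

/-- High powers of e vanish, and above degree m − d the factor produced by the trace is negative, so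
vanishing descends from e^{k+j+1} X to e^{k+j} X, down to j = 0. -/
theorem cof_pow_mul_eq_zero {d k : ℕ} {X : Ext T W} (hX : X ∈ totalDegree T W d)
    (h0 : cin T s.coord X = 0) (ht : tr b s.proj X = 0) (hk : Fintype.card κ < k + d) :
    cof b e ^ k * X = 0 := by
  obtain ⟨K, hK⟩ := isNilpotent_cof b e
  suffices ∀ j, cof b e ^ (k + j) * X = 0 → cof b e ^ k * X = 0 from
    this K (by rw [pow_add, hK, mul_zero, zero_mul])
  intro j
  induction j with
  | zero => exact id
  | succ j ih =>
    intro h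
    refine ih ?_
    have := tr_cof_pow_mul (b := b) s hX h0 (k + j)
    rw [add_assoc, h, map_zero, ht, mul_zero, zero_add, eq_comm, smul_eq_zero] at this
    refine this.resolve_left (mul_ne_zero (by positivity) ?_)
    have : (Fintype.card κ : ℝ) < k + d := by exact_mod_cast hk
    push_cast
    have : (0 : ℝ) ≤ j := by positivity
    linarith

theorem cin_cv (d : Dual ℝ W) (ξ : Dual ℝ T) : cin T d (cv T W ξ) = 0 := by
  have := cin_cv_mul d ξ 1
  simpa using this

theorem cin_vc (d : Dual ℝ W) (w : W) : cin T d (vc T W w) = d w • 1 := by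
  have := cin_vc_mul (T := T) d w 1
  simpa using this

theorem cin_eq_zero_of_mem {X : Ext T W} (d : Dual ℝ W) (hX : X ∈ bideg T W 2 0) :
    cin T d X = 0 := by
  refine bideg_two_zero_le (P := LinearMap.ker (cin T d)) (fun ξ ξ' ↦ ?_) hX
  rw [LinearMap.mem_ker, cin_cv_mul, cin_cv]; simp

theorem tr_eq_zero {r : W →ₗ[ℝ] T} {X : Ext T W} (h : ∀ d, cin T d X = 0) : tr b r X = 0 := by
  rw [tr_apply]
  exact Finset.sum_eq_zero fun μ _ ↦ by rw [cin_ins, h, map_zero, neg_zero]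

theorem tr_cv {r : W →ₗ[ℝ] T} (ξ : Dual ℝ T) : tr b r (cv T W ξ) = 0 :=
  tr_eq_zero fun d ↦ cin_cv d ξ

theorem cin_mem_bideg {X : Ext T W} (d : Dual ℝ W) (hX : X ∈ bideg T W 2 1) :
    cin T d X ∈ bideg T W 2 0 := by
  refine bideg_two_one_le (P := (bideg T W 2 0).comap (cin T d)) (fun ξ ξ' w ↦ ?_) hX
  rw [Submodule.mem_comap, mul_assoc, cin_cv_mul, cin_cv_mul, cin_vc]
  simp only [mul_smul_comm, mul_one, mul_neg, neg_neg]
  exact Submodule.smul_mem _ _ (mul_mem_bideg (cv_mem_bideg (W := W) ξ) (cv_mem_bideg ξ') :)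

theorem ins_vc (u : T) (w : W) : ins W u (vc T W w) = 0 := by
  have := ins_vc_mul u w (1 : Ext T W)
  simpa using this

theorem ins_cv_cv_vc (u : T) (ξ ξ' : Dual ℝ T) (w : W) :
    ins W u (cv T W ξ * cv T W ξ' * vc T W w) =
      ξ u • (cv T W ξ' * vc T W w) - ξ' u • (cv T W ξ * vc T W w) := by
  rw [mul_assoc, ins_cv_mul, ins_cv_mul, ins_vc]
  simp

theorem ins_ins_cv_cv_vc (u u' : T) (ξ ξ' : Dual ℝ T) (w : W) :
    ins W u' (ins W u (cv T W ξ * cv T W ξ' * vc T W w)) =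
      (ξ u * ξ' u' - ξ' u * ξ u') • vc T W w := by
  rw [ins_cv_cv_vc, map_sub, map_smul, map_smul, ins_cv_mul, ins_cv_mul, ins_vc]
  simp [smul_smul, sub_smul]

theorem tr_mem_bideg {r : W →ₗ[ℝ] T} {X : Ext T W} (hX : X ∈ bideg T W 2 1) :
    tr b r X ∈ bideg T W 1 0 := by
  refine bideg_two_one_le (P := (bideg T W 1 0).comap (tr b r)) (fun ξ ξ' w ↦ ?_) hX
  rw [Submodule.mem_comap, tr_apply]
  refine Submodule.sum_mem _ fun μ _ ↦ ?_
  rw [ins_cv_cv_vc, map_sub, map_smul, map_smul, cin_cv_mul, cin_cv_mul, cin_vc]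
  simp only [mul_smul_comm, mul_one]
  exact Submodule.sub_mem _ (Submodule.smul_mem _ _ (Submodule.neg_mem _
    (Submodule.smul_mem _ _ (cv_mem_bideg ξ')))) (Submodule.smul_mem _ _ (Submodule.neg_mem _
    (Submodule.smul_mem _ _ (cv_mem_bideg ξ))))

/-- The n-component is a pure 2-form, hence trace-free, and e^{m-2} is injective on it. -/
theorem cin_coord_eq_zero {k : ℕ} (hk : k + 2 = Fintype.card κ) {Y : Ext T W}
    (hY : Y ∈ bideg T W 2 1) (h : cof b e ^ k * Y = 0) : cin T s.coord Y = 0 := by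
  have hm := cin_mem_bideg s.coord hY
  refine eq_zero_of_cof_pow_mul (b := b) (k := k) s (bideg_le_totalDegree _ _ hm) (cin_self _ _)
    (tr_eq_zero fun d ↦ cin_eq_zero_of_mem d hm) hk.le ?_
  rw [← cin_cof_pow_mul b e s.coord_comp, h, map_zero]

theorem cof_pow_mul_cv_injective (s : Splitting e n) {k : ℕ} (hk : k + 1 ≤ Fintype.card κ)
    {ξ : Dual ℝ T}
    (h : cof b e ^ k * cv T W ξ = 0) : cv T W ξ = 0 :=
  eq_zero_of_cof_pow_mul (b := b) (k := k) s (cv_mem_totalDegree ξ) (cin_cv _ _) (tr_cv _) hk h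

theorem tr_eq_zero_of_cof_pow_mul (s : Splitting e n) {k : ℕ} (hk : k + 2 = Fintype.card κ)
    {Y : Ext T W}
    (hY : Y ∈ bideg T W 2 1) (h : cof b e ^ k * Y = 0) : tr b s.proj Y = 0 := by
  obtain ⟨ξ, hξ⟩ := exists_cv_of_mem_bideg (tr_mem_bideg (b := b) (r := s.proj) hY)
  rw [← hξ]
  refine cof_pow_mul_cv_injective (b := b) (k := k) s (by omega) ?_
  rcases k with _ | k
  · rw [hξ, pow_zero, one_mul]
    rw [pow_zero, one_mul] at h
    rw [h, map_zero]
  have := tr_cof_pow_mul (b := b) s (bideg_le_totalDegree _ _ hY)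
    (cin_coord_eq_zero s hk hY h) k
  have hc : (Fintype.card κ : ℝ) = k + 1 + 2 := by rw [← hk]; push_cast; ring
  rw [h, map_zero, ← hξ, hc] at this
  -- In degree 3 the Lefschetz factor for the exponent m − 2 is exactly zero: the trace commutes
  -- with this power, so e^{m-2} kills the 1-form Λ Y.
  have h0 : ((k : ℝ) + 1) * (k + 1 + 2 - ((2 + 1 : ℕ) : ℝ) - k) = 0 := by push_cast; ring
  rw [h0, zero_smul, add_zero] at this
  exact this.symm

/-- The component of `Y` in the kernel of `e^{m-2}` vanishes if `n e^{m-3} Y` is in the image. -/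
theorem eq_zero_of_mul_eq (s : Splitting e n) {k : ℕ} (hk : k + 3 = Fintype.card κ) {X Y : Ext T W}
    (hX : X ∈ bideg T W 1 1) (hY : Y ∈ bideg T W 2 1) (h : cof b e ^ (k + 1) * Y = 0)
    (h' : vc T W n * cof b e ^ k * Y = cof b e ^ (k + 1) * X) : Y = 0 := by
  have hn := cin_coord_eq_zero s (b := b) (k := k + 1) (by omega) hY h
  have ht := tr_eq_zero_of_cof_pow_mul s (b := b) (k := k + 1) (by omega) hY h
  obtain ⟨ξ, hξ⟩ : ∃ ξ, cv T W ξ = cin T s.coord X := by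
    refine bideg_one_one_le
      (P := (LinearMap.range (cv T W)).comap (cin T s.coord)) (fun ξ w ↦ ?_) hX
    rw [Submodule.mem_comap, cin_cv_mul, cin_vc]
    exact ⟨-(s.coord w • ξ), by simp⟩
  -- The n-component of `h'`: Y itself has none, so on the right only the n-component ξ of X
  -- survives.
  have h1 : cof b e ^ k * Y = cof b e ^ (k + 1) * cv T W ξ := by
    have := congrArg (cin T s.coord) h'
    rwa [mul_assoc, cin_vc_mul, s.coord_self, one_smul, cin_cof_pow_mul b e s.coord_comp,
      cin_cof_pow_mul b e s.coord_comp, hn, mul_zero, mul_zero, sub_zero, ← hξ] at this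
  -- One more factor e kills the left side, and e^{m-1} is still injective on 1-forms.
  have h2 : cv T W ξ = 0 := by
    refine cof_pow_mul_cv_injective (b := b) (k := k + 2) s (by omega) ?_
    rw [pow_succ', mul_assoc, ← h1, ← mul_assoc, ← pow_succ', h]
  rw [h2, mul_zero] at h1
  exact eq_zero_of_cof_pow_mul (b := b) (k := k) s (bideg_le_totalDegree _ _ hY) hn ht
    (by omega) h1

theorem vc_mul_comm {X : Ext T W} (hX : X ∈ bideg T W 2 0) (w : W) :
    X * vc T W w = vc T W w * X := by
  refine bideg_two_zero_le (P := LinearMap.eqLocus (LinearMap.mulRight ℝ (vc T W w))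
    (LinearMap.mulLeft ℝ (vc T W w))) (fun ξ ξ' ↦ ?_) hX
  exact commute_ι_mul_ι _ _ _

/-- Remove the n-component with B and then the trace with ξ. What remains is trace-free of degree 3,
and (m − 2) + 3 > m. -/
theorem exists_decomposition (s : Splitting e n) {k : ℕ} (hk : k + 2 = Fintype.card κ) {Y : Ext T W}
    (hY : Y ∈ bideg T W 2 1) : ∃ ξ : Dual ℝ T, ∃ B ∈ bideg T W 2 0,
      cof b e ^ k * (Y - cof b e * cv T W ξ - B * vc T W n) = 0 := by
  have hB := cin_mem_bideg s.coord hY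
  set B := cin T s.coord Y with hBd
  have hZ : Y - B * vc T W n ∈ bideg T W 2 1 :=
    Submodule.sub_mem _ hY (mul_mem_bideg hB (vc_mem_bideg n) :)
  have hZn : cin T s.coord (Y - B * vc T W n) = 0 := by
    rw [map_sub, vc_mul_comm hB, cin_vc_mul, cin_eq_zero_of_mem _ hB, s.coord_self, ← hBd]; simp
  obtain ⟨ξ, hξ⟩ := exists_cv_of_mem_bideg (tr_mem_bideg (b := b) (r := s.proj) hZ)
  have hm : ((Fintype.card κ : ℝ) - 1) ≠ 0 := by
    have : (Fintype.card κ : ℝ) = k + 2 := by rw [← hk]; push_cast; ring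
    rw [this]
    have : (0 : ℝ) ≤ k := by positivity
    linarith
  -- The normalisation comes from Λ(eξ) = (m − 1) ξ for a 1-form ξ.
  refine ⟨((Fintype.card κ : ℝ) - 1)⁻¹ • ξ, B, hB, ?_⟩
  have hL : cof b e * cv T W (((Fintype.card κ : ℝ) - 1)⁻¹ • ξ) ∈ bideg T W 2 1 :=
    (mul_mem_bideg (cof_mem_bideg b e)
      (cv_mem_bideg (((Fintype.card κ : ℝ) - 1)⁻¹ • ξ)) :)
  rw [sub_right_comm]
  refine cof_pow_mul_eq_zero (b := b) s
    (bideg_le_totalDegree _ _ (Submodule.sub_mem _ hZ hL)) ?_ ?_ (by omega)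
  · have := cin_cof_pow_mul b e s.coord_comp 1 (cv T W (((Fintype.card κ : ℝ) - 1)⁻¹ • ξ))
    rw [pow_one, cin_cv, mul_zero] at this
    rw [map_sub, hZn, this, sub_zero]
  · have := tr_cof_pow_mul (b := b) s
      (cv_mem_totalDegree (((Fintype.card κ : ℝ) - 1)⁻¹ • ξ)) (cin_cv _ _) 0
    rw [zero_add, pow_one, pow_zero, one_mul, tr_cv, mul_zero, zero_add] at this
    rw [map_sub, this, ← hξ, map_smul, smul_smul]
    push_cast
    rw [zero_add, one_mul, sub_zero, mul_inv_cancel₀ hm, one_smul, sub_self]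

/-- This and `eq_zero_of_mul_vc` are the injectivity statements from which smoothness of α and β is
deduced. -/
theorem cv_eq_zero_of_vc_mul (s : Splitting e n) {k : ℕ} (hk : k + 1 = Fintype.card κ) {X : Ext T W}
    (hX : X ∈ bideg T W 1 0) (h : X * (vc T W n * cof b e ^ k) = 0) : X = 0 := by
  obtain ⟨ξ, rfl⟩ := exists_cv_of_mem_bideg hX
  refine cof_pow_mul_cv_injective (b := b) (k := k) s hk.le ?_
  rw [← mul_assoc, cv_mul_vc, neg_mul, mul_assoc, ← (commute_cof_pow b e k _).eq,
    neg_eq_zero] at h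
  have := congrArg (cin T s.coord) h
  rwa [cin_vc_mul, s.coord_self, one_smul, cin_cof_pow_mul b e s.coord_comp, cin_cv, map_zero,
    mul_zero, mul_zero, sub_zero] at this

theorem eq_zero_of_mul_vc (s : Splitting e n) {k : ℕ} (hk : k + 2 = Fintype.card κ) {X : Ext T W}
    (hX : X ∈ bideg T W 2 0) (h : X * (vc T W n * cof b e ^ k) = 0) : X = 0 := by
  refine eq_zero_of_cof_pow_mul (b := b) (k := k) s (bideg_le_totalDegree _ _ hX)
    (cin_eq_zero_of_mem _ hX) (tr_eq_zero fun d ↦ cin_eq_zero_of_mem d hX) hk.le ?_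
  rw [← mul_assoc, vc_mul_comm hX, mul_assoc, ← (commute_cof_pow b e k _).eq] at h
  have := congrArg (cin T s.coord) h
  rwa [cin_vc_mul, s.coord_self, one_smul, cin_cof_pow_mul b e s.coord_comp,
    cin_eq_zero_of_mem _ hX, map_zero, mul_zero, mul_zero, sub_zero] at this

end Lefschetz

/-! ### The bracket with e, values of two-forms, and the orthogonality relation -/

section Contraction

variable {T W : Type*} [AddCommGroup T] [Module ℝ T] [AddCommGroup W] [Module ℝ W]

variable (T) in
/-- Right contraction with a covector of `W`. -/
def cinR (d : Dual ℝ W) : Ext T W →ₗ[ℝ] Ext T W :=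
  CliffordAlgebra.contractRight.flip (d ∘ₗ LinearMap.snd ℝ _ _)

variable (T W) in
/-- The component in `W`. -/
def vp : Ext T W →ₗ[ℝ] W := LinearMap.snd ℝ _ _ ∘ₗ ExteriorAlgebra.ιInv

@[simp] theorem vp_vc (w : W) : vp T W (vc T W w) = w := by
  have : ExteriorAlgebra.ιInv (vc T W w) = ((0, w) : Dual ℝ T × W) :=
    ExteriorAlgebra.ι_leftInverse ((0, w) : Dual ℝ T × W)
  rw [vp, LinearMap.comp_apply, this]; rfl

theorem cinR_mul_cv (d : Dual ℝ W) (ξ : Dual ℝ T) (X : Ext T W) :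
    cinR T d (X * cv T W ξ) = -(cinR T d X * cv T W ξ) := by
  refine (CliffordAlgebra.contractRight_mul_ι _ _ _).trans ?_
  simp [cinR, cv]

theorem cinR_mul_vc (d : Dual ℝ W) (w : W) (X : Ext T W) :
    cinR T d (X * vc T W w) = d w • X - cinR T d X * vc T W w :=
  CliffordAlgebra.contractRight_mul_ι _ _ _

theorem cinR_one (d : Dual ℝ W) : cinR T d 1 = 0 :=
  CliffordAlgebra.contractRight_one (Q := 0) _

theorem cinR_cv (d : Dual ℝ W) (ξ : Dual ℝ T) : cinR T d (cv T W ξ) = 0 := by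
  have := cinR_mul_cv d ξ 1
  simpa [cinR_one] using this

theorem cinR_vc (d : Dual ℝ W) (w : W) : cinR T d (vc T W w) = d w • 1 := by
  have := cinR_mul_vc (T := T) d w 1
  simpa [cinR_one] using this

theorem cinR_vc_vc (d : Dual ℝ W) (w w' : W) :
    cinR T d (vc T W w * vc T W w') = vc T W (d w' • w - d w • w') := by
  rw [cinR_mul_vc, cinR_vc]; simp

theorem cinR_cv_vc_vc (d : Dual ℝ W) (ξ : Dual ℝ T) (w w' : W) :
    cinR T d (cv T W ξ * (vc T W w * vc T W w')) = cv T W ξ * vc T W (d w' • w - d w • w') := by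
  rw [← mul_assoc, cinR_mul_vc, cinR_mul_vc, cinR_cv]; simp [mul_sub]

theorem ins_cv_vc_vc (u : T) (ξ : Dual ℝ T) (w w' : W) :
    ins W u (cv T W ξ * (vc T W w * vc T W w')) = ξ u • (vc T W w * vc T W w') := by
  rw [ins_cv_mul, ins_vc_mul, ins_vc]; simp

variable {κ : Type*} [Fintype κ] (b : Basis κ ℝ T) (e : T →ₗ[ℝ] W) (g : W →ₗ[ℝ] Dual ℝ W)

theorem cinR_mul_cof (d : Dual ℝ W) (X : Ext T W) :
    cinR T d (X * cof b e) = X * cv T W (d ∘ₗ e) + cinR T d X * cof b e := by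
  rw [cv_eq_sum b (d ∘ₗ e)]
  simp only [cof, Finset.mul_sum, map_sum, ← mul_assoc, cinR_mul_vc, cinR_mul_cv, neg_mul,
    sub_neg_eq_add, Finset.sum_add_distrib, mul_smul_comm, LinearMap.comp_apply]

theorem cinR_mul_cof_pow (d : Dual ℝ W) (X : Ext T W) (k : ℕ) :
    cinR T d (X * cof b e ^ (k + 1)) =
      cinR T d X * cof b e ^ (k + 1) + ((k : ℝ) + 1) • (X * cof b e ^ k * cv T W (d ∘ₗ e)) := by
  induction k with
  | zero => simp [cinR_mul_cof, add_comm]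
  | succ k ih =>
    have hc : X * cof b e ^ k * cv T W (d ∘ₗ e) * cof b e =
        X * cof b e ^ (k + 1) * cv T W (d ∘ₗ e) := by
      rw [mul_assoc, ← (commute_cof b e _).eq, ← mul_assoc, mul_assoc X, ← pow_succ]
    rw [pow_succ _ (k + 1), ← mul_assoc, cinR_mul_cof, ih, add_mul, smul_mul_assoc, hc,
      ← mul_assoc]
    push_cast
    module

/-- The map `X ↦ [X, e]`. -/
def brk : Ext T W →ₗ[ℝ] Ext T W :=
  -∑ ν, LinearMap.mulLeft ℝ (cv T W (b.coord ν)) ∘ₗ cinR T (g (e (b ν)))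

theorem brk_apply (X : Ext T W) :
    brk b e g X = -∑ ν, cv T W (b.coord ν) * cinR T (g (e (b ν))) X := by
  simp [brk]

/-- A symmetric tensor (the induced metric) is contracted with an antisymmetric product. -/
theorem sum_cv_mul_cv_eq_zero (hg : ∀ s t, g s t = g t s) :
    ∑ ν, cv T W (b.coord ν) * cv T W (g (e (b ν)) ∘ₗ e) = 0 := by
  have h : ∑ ν, cv T W (b.coord ν) * cv T W (g (e (b ν)) ∘ₗ e) =
      -∑ ν, cv T W (b.coord ν) * cv T W (g (e (b ν)) ∘ₗ e) := by
    simp_rw [cv_eq_sum b (g (e (b _)) ∘ₗ e), Finset.mul_sum, ← Finset.sum_neg_distrib]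
    rw [Finset.sum_comm]
    refine Finset.sum_congr rfl fun μ _ ↦ Finset.sum_congr rfl fun ν _ ↦ ?_
    rw [mul_smul_comm, mul_smul_comm, cv_mul_cv, smul_neg, LinearMap.comp_apply,
      LinearMap.comp_apply, hg]
  have : (2 : ℝ) • ∑ ν, cv T W (b.coord ν) * cv T W (g (e (b ν)) ∘ₗ e) = 0 := by
    rw [two_smul]; nth_rewrite 1 [h]; exact neg_add_cancel _
  simpa using this

/-- Contracting X e^k = 0 with η(e_ν, ·) trades the contraction of X for a term containing the
1-form η(e_ν, e ·). After wedging with dx^ν and summing, symmetry of the metric kills these terms.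
-/
theorem brk_mul_cof_pow (hg : ∀ s t, g s t = g t s) {X : Ext T W} (hX : X ∈ bideg T W 1 2) {k : ℕ}
    (h : X * cof b e ^ k = 0) : brk b e g X * cof b e ^ k = 0 := by
  rcases k with _ | k
  · rw [pow_zero, mul_one] at h
    rw [h, map_zero, zero_mul]
  have key (ν : κ) : cv T W (b.coord ν) * cinR T (g (e (b ν))) X * cof b e ^ (k + 1) =
      ((k : ℝ) + 1) • (X * cof b e ^ k *
        (cv T W (b.coord ν) * cv T W (g (e (b ν)) ∘ₗ e))) := by
    have h1 := cinR_mul_cof_pow b e (g (e (b ν))) X k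
    rw [h, map_zero] at h1
    have h2 := cv_mul_comm (bideg_le_totalDegree _ _ hX) (b.coord ν)
    rw [mul_assoc, eq_neg_of_add_eq_zero_left h1.symm, mul_neg, mul_smul_comm, ← mul_assoc,
      ← mul_assoc, h2]
    simp only [mul_assoc, smul_mul_assoc]
    rw [← mul_assoc (cv T W (b.coord ν)), ← (commute_cof_pow b e k _).eq]
    norm_num [mul_assoc]
  rw [brk_apply, neg_mul, Finset.sum_mul, Finset.sum_congr rfl fun ν _ ↦ key ν,
    ← Finset.smul_sum, ← Finset.mul_sum, sum_cv_mul_cv_eq_zero b e g hg]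
  simp

/-- Frame independence: the bases `tangentBasis x` need not vary smoothly with x, so smoothness is
checked after passing to a local frame. -/
theorem sum_basis_change {κ' : Type*} [Fintype κ'] (b' : Basis κ' ℝ T) (f : T →ₗ[ℝ] Ext T W) :
    ∑ μ, cv T W (b.coord μ) * f (b μ) = ∑ μ, cv T W (b'.coord μ) * f (b' μ) := by
  have h (ν : κ') : f (b' ν) = ∑ μ, b.coord μ (b' ν) • f (b μ) := by
    simp_rw [← map_smul, ← map_sum, Basis.coord_apply]
    rw [b.sum_repr]
  simp_rw [h, cv_eq_sum b' (b.coord _), Finset.sum_mul, Finset.mul_sum]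
  rw [Finset.sum_comm]
  simp

theorem sum_sum_basis_change {κ' : Type*} [Fintype κ'] (b' : Basis κ' ℝ T)
    (f : T →ₗ[ℝ] T →ₗ[ℝ] W) :
    ∑ μ, ∑ ν, cv T W (b.coord μ) * cv T W (b.coord ν) * vc T W (f (b μ) (b ν)) =
      ∑ μ, ∑ ν, cv T W (b'.coord μ) * cv T W (b'.coord ν) * vc T W (f (b' μ) (b' ν)) := by
  have h (u : T) := sum_basis_change b b' (vc T W ∘ₗ f u)
  let F : T →ₗ[ℝ] Ext T W :=
    ∑ ν, LinearMap.mulLeft ℝ (cv T W (b'.coord ν)) ∘ₗ vc T W ∘ₗ f.flip (b' ν)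
  have hF (u : T) : F u = ∑ ν, cv T W (b'.coord ν) * vc T W (f u (b' ν)) := by simp [F]
  simp only [LinearMap.comp_apply] at h
  simp_rw [mul_assoc, ← Finset.mul_sum, h, ← hF]
  exact sum_basis_change b b' F

/-- This identifies the contribution of ω to the torsion with [ω, e]. The factor 1/2 compensates for
counting each pair μ, ν in both orders. -/
theorem sum_sum_act_eq_brk {X : Ext T W} (hX : X ∈ bideg T W 1 2) :
    (1 / 2 : ℝ) • ∑ μ, ∑ ν, cv T W (b.coord μ) * cv T W (b.coord ν) *
      vc T W (vp T W (cinR T (g (e (b ν))) (ins W (b μ) X)) -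
        vp T W (cinR T (g (e (b μ))) (ins W (b ν) X))) = brk b e g X := by
  let P := LinearMap.eqLocus (brk b e g)
    ((1 / 2 : ℝ) • ∑ μ, ∑ ν, LinearMap.mulLeft ℝ (cv T W (b.coord μ) * cv T W (b.coord ν)) ∘ₗ
      vc T W ∘ₗ (vp T W ∘ₗ cinR T (g (e (b ν))) ∘ₗ ins W (b μ) -
        vp T W ∘ₗ cinR T (g (e (b μ))) ∘ₗ ins W (b ν)))
  have hP : X ∈ P := by
    refine bideg_one_two_le (fun ξ w w' ↦ ?_) hX
    let β (ν : κ) : W := g (e (b ν)) w' • w - g (e (b ν)) w • w'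
    have h1 : ∑ μ, ∑ ν, cv T W (b.coord μ) * cv T W (b.coord ν) * vc T W (ξ (b μ) • β ν) =
        ∑ ν, cv T W ξ * cv T W (b.coord ν) * vc T W (β ν) := by
      rw [Finset.sum_comm]
      refine Finset.sum_congr rfl fun ν _ ↦ ?_
      rw [cv_eq_sum b ξ, Finset.sum_mul, Finset.sum_mul]
      simp
    have h2 : ∑ μ, ∑ ν, cv T W (b.coord μ) * cv T W (b.coord ν) * vc T W (ξ (b ν) • β μ) =
        -∑ ν, cv T W ξ * cv T W (b.coord ν) * vc T W (β ν) := by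
      rw [← Finset.sum_neg_distrib]
      refine Finset.sum_congr rfl fun μ _ ↦ ?_
      rw [cv_mul_cv ξ, neg_mul, neg_neg, cv_eq_sum b ξ, Finset.mul_sum, Finset.sum_mul]
      simp
    have h3 : brk b e g (cv T W ξ * (vc T W w * vc T W w')) =
        ∑ ν, cv T W ξ * cv T W (b.coord ν) * vc T W (β ν) := by
      rw [brk_apply, ← Finset.sum_neg_distrib]
      refine Finset.sum_congr rfl fun ν _ ↦ ?_
      rw [cinR_cv_vc_vc, cv_mul_cv ξ, neg_mul, ← mul_assoc]
    have h4 (μ ν : κ) : vp T W (cinR T (g (e (b ν))) (ins W (b μ)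
        (cv T W ξ * (vc T W w * vc T W w')))) = ξ (b μ) • β ν := by
      rw [ins_cv_vc_vc, map_smul, map_smul, cinR_vc_vc, vp_vc]
    rw [LinearMap.mem_eqLocus, h3]
    simp only [LinearMap.smul_apply, LinearMap.sum_apply, LinearMap.comp_apply,
      LinearMap.sub_apply, LinearMap.mulLeft_apply, h4, map_sub, Finset.sum_sub_distrib]
    rw [h1, h2]
    module
  rw [LinearMap.mem_eqLocus] at hP
  rw [hP]
  simp [mul_assoc]

/-- The value at `(u, w)` of a two-form with values in `W`. -/
def ev (X : Ext T W) (u w : T) : W := vp T W (ins W w (ins W u X))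

theorem vc_ev {X : Ext T W} (hX : X ∈ bideg T W 2 1) (u w : T) :
    vc T W (ev X u w) = ins W w (ins W u X) := by
  refine bideg_two_one_le (P := LinearMap.eqLocus
    (vc T W ∘ₗ vp T W ∘ₗ ins W w ∘ₗ ins W u) (ins W w ∘ₗ ins W u)) (fun ξ ξ' v ↦ ?_) hX
  simp only [LinearMap.mem_eqLocus, LinearMap.comp_apply, ins_ins_cv_cv_vc, map_smul, vp_vc]

theorem ev_swap (X : Ext T W) (u w : T) : ev X u w = -ev X w u := by
  rw [ev, ins_ins, map_neg, ev]

theorem ev_add (X Y : Ext T W) (u w : T) : ev (X + Y) u w = ev X u w + ev Y u w := by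
  simp [ev]

theorem ev_eq_zero {X : Ext T W} (hX : X ∈ bideg T W 2 1) (h : ∀ μ ν, ev X (b μ) (b ν) = 0) :
    X = 0 := by
  have h2 : X ∈ LinearMap.eqLocus LinearMap.id ((1 / 2 : ℝ) • ∑ μ, ∑ ν,
      LinearMap.mulLeft ℝ (cv T W (b.coord μ) * cv T W (b.coord ν)) ∘ₗ vc T W ∘ₗ
        vp T W ∘ₗ ins W (b ν) ∘ₗ ins W (b μ)) := by
    refine bideg_two_one_le (fun ξ ξ' w ↦ ?_) hX
    have h1 (ξ ξ' : Dual ℝ T) : ∑ μ, ∑ ν, cv T W (b.coord μ) * cv T W (b.coord ν) *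
        vc T W ((ξ (b μ) * ξ' (b ν)) • w) = cv T W ξ * cv T W ξ' * vc T W w := by
      conv_rhs => rw [cv_eq_sum b ξ, cv_eq_sum b ξ', Finset.sum_mul, Finset.sum_mul]
      refine Finset.sum_congr rfl fun μ _ ↦ ?_
      rw [Finset.mul_sum, Finset.sum_mul]
      refine Finset.sum_congr rfl fun ν _ ↦ ?_
      simp [smul_smul, mul_comm]
    have h2 (u u' : T) : vp T W (ins W u' (ins W u (cv T W ξ * cv T W ξ' * vc T W w))) =
        (ξ u * ξ' u') • w - (ξ' u * ξ u') • w := by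
      rw [ins_ins_cv_cv_vc, map_smul, vp_vc, sub_smul]
    simp only [LinearMap.mem_eqLocus, LinearMap.smul_apply, LinearMap.sum_apply,
      LinearMap.comp_apply, LinearMap.mulLeft_apply, h2, LinearMap.id_apply, map_sub,
      Finset.sum_sub_distrib, h1]
    rw [cv_mul_cv ξ' ξ, neg_mul]
    module
  rw [LinearMap.mem_eqLocus] at h2
  rw [← LinearMap.id_apply (R := ℝ) X, h2]
  simp only [LinearMap.smul_apply, LinearMap.sum_apply, LinearMap.comp_apply,
    LinearMap.mulLeft_apply]
  refine smul_eq_zero_of_right _ (Finset.sum_eq_zero fun μ _ ↦ Finset.sum_eq_zero fun ν _ ↦ ?_)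
  have := h μ ν
  rw [ev] at this
  rw [this, map_zero, mul_zero]

theorem ev_cof_mul_cv (ξ : Dual ℝ T) (u w : T) :
    ev (cof b e * cv T W ξ) u w = ξ u • e w - ξ w • e u := by
  have h (u : T) : ins W u (cof b e) = vc T W (e u) := by
    have := ins_cof_mul b e u 1
    simpa using this
  rw [ev, (commute_cof b e _).eq, ins_cv_mul, map_sub, map_smul, h, h, ins_cv_mul, ins_vc]
  simp

theorem ev_mul_vc {B : Ext T W} (hB : B ∈ bideg T W 2 0) (n : W) (u w : T) :
    ∃ c : ℝ, ev (B * vc T W n) u w = c • n := by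
  have : B ∈ (ℝ ∙ n).comap (vp T W ∘ₗ ins W w ∘ₗ ins W u ∘ₗ LinearMap.mulRight ℝ (vc T W n)) := by
    refine bideg_two_zero_le (fun ξ ξ' ↦ ?_) hB
    simp only [Submodule.mem_comap, LinearMap.comp_apply, LinearMap.mulRight_apply,
      ins_ins_cv_cv_vc, map_smul, vp_vc]
    exact Submodule.smul_mem _ _ (Submodule.mem_span_singleton_self n)
  obtain ⟨c, hc⟩ := Submodule.mem_span_singleton.mp this
  exact ⟨c, hc.symm⟩

variable {b e} {n : W}

/-- Orthogonality of `ker e^{m-2}` to the complement `e Ω^{1,0} + n Ω^{2,0}`. -/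
theorem sum_inner_ev_eq_zero (s : Splitting e n) {k : ℕ} (hk : k + 2 = Fintype.card κ)
    (G : W →ₗ[ℝ] W →ₗ[ℝ] ℝ) (hn : ∀ u, G n (e u) = 0)
    (hG : ∀ i (u : T), G (e (b i)) (e u) = b.coord i u) {θ : Ext T W} (hθ : θ ∈ bideg T W 2 1)
    (h : cof b e ^ k * θ = 0) (ξ : Dual ℝ T) {B : Ext T W} (hB : B ∈ bideg T W 2 0) :
    ∑ i, ∑ j, G (ev (cof b e * cv T W ξ + B * vc T W n) (b i) (b j)) (ev θ (b i) (b j)) = 0 := by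
  -- Membership in the kernel means that θ takes values in e(T) and has zero trace. The B n part
  -- then pairs to zero by `hn`, and the e ξ part pairs to traces of θ.
  have h1 := cin_coord_eq_zero s hk hθ h
  have h2 := tr_eq_zero_of_cof_pow_mul s hk hθ h
  have h3 (u w : T) : s.coord (ev θ u w) = 0 := by
    have := cin_vc (T := T) s.coord (ev θ u w)
    rw [vc_ev hθ, cin_ins, cin_ins, h1, map_zero, neg_zero, map_zero, neg_zero, eq_comm,
      smul_eq_zero] at this
    exact this.resolve_right one_ne_zero
  have h4 (u w : T) : e (s.proj (ev θ u w)) = ev θ u w := by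
    have := s.decomp (ev θ u w)
    rwa [h3, zero_smul, add_zero] at this
  have h5 (w : T) : ∑ i, b.coord i (s.proj (ev θ (b i) w)) = 0 := by
    have := congrArg (ins W w) h2
    rw [map_zero, tr_apply, map_sum] at this
    have h6 (i : κ) : ins W w (cin T (b.coord i ∘ₗ s.proj) (ins W (b i) θ)) =
        (-b.coord i (s.proj (ev θ (b i) w))) • 1 := by
      rw [← neg_eq_iff_eq_neg.mpr (cin_ins _ _ _), ← vc_ev hθ, cin_vc, neg_smul]
      rfl
    rw [Finset.sum_congr rfl fun i _ ↦ h6 i, ← Finset.sum_smul, smul_eq_zero,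
      Finset.sum_neg_distrib, neg_eq_zero] at this
    exact this.resolve_right one_ne_zero
  have key (i j : κ) : G (ev (cof b e * cv T W ξ + B * vc T W n) (b i) (b j)) (ev θ (b i) (b j)) =
      -(ξ (b i) * b.coord j (s.proj (ev θ (b j) (b i)))) -
        ξ (b j) * b.coord i (s.proj (ev θ (b i) (b j))) := by
    obtain ⟨c, hc⟩ := ev_mul_vc hB n (b i) (b j)
    rw [ev_add, ev_cof_mul_cv, hc, ← h4 (b i) (b j)]
    simp only [map_add, map_sub, map_smul, LinearMap.add_apply, LinearMap.sub_apply,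
      LinearMap.smul_apply, hn, hG]
    rw [h4, ev_swap θ (b j) (b i), map_neg, map_neg]
    simp
  simp_rw [key, Finset.sum_sub_distrib, Finset.sum_neg_distrib, ← Finset.mul_sum, h5]
  rw [Finset.sum_comm]
  simp_rw [← Finset.mul_sum, h5]
  simp

end Contraction

/-! ### Smoothness tested on linear functionals, and smooth linear systems -/

section WeakSmoothness

instance {M : Type*} [AddCommGroup M] [Module ℝ M] [FiniteDimensional ℝ M] :
    FiniteDimensional ℝ (ExteriorAlgebra ℝ M) := by
  classical
  exact Module.Finite.of_basis ((finBasis ℝ M).ExteriorAlgebra)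

variable {E : Type*} [NormedAddCommGroup E] [NormedSpace ℝ E]
  {S : Type*} [TopologicalSpace S] [ChartedSpace E S]
  {A B C : Type*} [AddCommGroup A] [Module ℝ A] [AddCommGroup B] [Module ℝ B]
  [AddCommGroup C] [Module ℝ C]

variable (E) in
/-- Smoothness of a map to a real vector space, tested on linear functionals. -/
def WSmoothAt (f : S → A) (x₀ : S) : Prop :=
  ∀ l : Dual ℝ A, ContMDiffAt 𝓘(ℝ, E) 𝓘(ℝ, ℝ) ∞ (fun x ↦ l (f x)) x₀

variable {f f' : S → A} {g : S → B} {x₀ : S}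

theorem WSmoothAt.map (hf : WSmoothAt E f x₀) (L : A →ₗ[ℝ] B) :
    WSmoothAt E (fun x ↦ L (f x)) x₀ :=
  fun l ↦ hf (l ∘ₗ L)

theorem wsmoothAt_const (a : A) : WSmoothAt E (fun _ : S ↦ a) x₀ :=
  fun _ ↦ contMDiffAt_const

theorem WSmoothAt.add (hf : WSmoothAt E f x₀) (hf' : WSmoothAt E f' x₀) :
    WSmoothAt E (fun x ↦ f x + f' x) x₀ := fun l ↦ by
  simp only [map_add]
  exact (hf l).add (hf' l)

theorem WSmoothAt.sum {ι : Type*} {s : Finset ι} {f : ι → S → A}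
    (hf : ∀ i ∈ s, WSmoothAt E (f i) x₀) : WSmoothAt E (fun x ↦ ∑ i ∈ s, f i x) x₀ := fun l ↦ by
  simp only [map_sum]
  exact ContMDiffAt.sum fun i hi ↦ hf i hi l

theorem WSmoothAt.congr (hf : WSmoothAt E f x₀) (h : f' =ᶠ[nhds x₀] f) : WSmoothAt E f' x₀ :=
  fun l ↦ (hf l).congr_of_eventuallyEq (h.fun_comp l)

theorem WSmoothAt.smul {c : S → ℝ} (hc : ContMDiffAt 𝓘(ℝ, E) 𝓘(ℝ, ℝ) ∞ c x₀)
    (hf : WSmoothAt E f x₀) : WSmoothAt E (fun x ↦ c x • f x) x₀ := fun l ↦ by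
  simp only [map_smul]
  exact hc.smul (hf l)

theorem WSmoothAt.map₂ [FiniteDimensional ℝ A] (hf : WSmoothAt E f x₀) (hg : WSmoothAt E g x₀)
    (L : A →ₗ[ℝ] B →ₗ[ℝ] C) : WSmoothAt E (fun x ↦ L (f x) (g x)) x₀ := by
  have h : (fun x ↦ L (f x) (g x)) =
      fun x ↦ ∑ i, (finBasis ℝ A).coord i (f x) • L (finBasis ℝ A i) (g x) := by
    funext x
    conv_lhs => rw [← (finBasis ℝ A).sum_repr (f x)]
    rw [map_sum, LinearMap.sum_apply]
    exact Finset.sum_congr rfl fun i _ ↦ by rw [map_smul]; rfl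
  rw [h]
  exact WSmoothAt.sum fun i _ ↦ WSmoothAt.smul (hf _) (hg.map _)

theorem ContMDiffAt.wsmoothAt {F : Type*} [NormedAddCommGroup F] [NormedSpace ℝ F]
    [FiniteDimensional ℝ F] {f : S → F} (hf : ContMDiffAt 𝓘(ℝ, E) 𝓘(ℝ, F) ∞ f x₀) :
    WSmoothAt E f x₀ := fun l ↦ by
  have hl : ContDiff ℝ ∞ (fun y : F ↦ l y) := (LinearMap.toContinuousLinearMap l).contDiff
  exact hl.contMDiff.contMDiffAt.comp x₀ hf

theorem WSmoothAt.of_basis {ι : Type*} [Fintype ι] (b : Basis ι ℝ A)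
    (h : ∀ i, ContMDiffAt 𝓘(ℝ, E) 𝓘(ℝ, ℝ) ∞ (fun x ↦ b.coord i (f x)) x₀) :
    WSmoothAt E f x₀ := by
  have h' : f = fun x ↦ ∑ i, b.coord i (f x) • b i := by
    funext x
    exact (b.sum_repr (f x)).symm
  rw [h']
  exact WSmoothAt.sum fun i _ ↦ WSmoothAt.smul (h i) (wsmoothAt_const _)

theorem contMDiffAt_det {ι : Type*} [Fintype ι] [DecidableEq ι] {M : S → Matrix ι ι ℝ}
    (hM : ∀ i j, ContMDiffAt 𝓘(ℝ, E) 𝓘(ℝ, ℝ) ∞ (fun x ↦ M x i j) x₀) :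
    ContMDiffAt 𝓘(ℝ, E) 𝓘(ℝ, ℝ) ∞ (fun x ↦ (M x).det) x₀ := by
  simp only [Matrix.det_apply']
  exact ContMDiffAt.sum fun σ _ ↦ contMDiffAt_const.mul
    (ContMDiffAt.prod fun i _ ↦ hM _ _)

/-- A solution of a smooth injective system of linear equations is smooth. -/
theorem WSmoothAt.of_injective [FiniteDimensional ℝ A] [FiniteDimensional ℝ B]
    {K : S → A →ₗ[ℝ] B} (hK : WSmoothAt E K x₀) (hinj : Function.Injective (K x₀))
    (h : WSmoothAt E (fun x ↦ K x (f x)) x₀) : WSmoothAt E f x₀ := by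
  classical
  -- P is a left inverse only at x₀, but P ∘ K x is a square matrix with smooth entries that is the
  -- identity at x₀, hence invertible nearby. Cramer's rule then writes the coordinates of f as
  -- quotients of smooth determinants.
  obtain ⟨P, hP⟩ := (K x₀).exists_leftInverse_of_injective (LinearMap.ker_eq_bot.mpr hinj)
  let b := finBasis ℝ A
  let M (x : S) := LinearMap.toMatrix b b (P ∘ₗ K x)
  have hM (i j) : ContMDiffAt 𝓘(ℝ, E) 𝓘(ℝ, ℝ) ∞ (fun x ↦ M x i j) x₀ := by
    have := hK (b.coord i ∘ₗ P ∘ₗ LinearMap.applyₗ (b j))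
    refine this.congr_of_eventuallyEq (Filter.Eventually.of_forall fun x ↦ ?_)
    simp [M, LinearMap.toMatrix_apply]
  have hdet := contMDiffAt_det hM
  have h0 : (M x₀).det ≠ 0 := by simp [M, hP]
  have hne : ∀ᶠ x in nhds x₀, (M x).det ≠ 0 := hdet.continuousAt.eventually_ne h0
  have hy (j) : ContMDiffAt 𝓘(ℝ, E) 𝓘(ℝ, ℝ) ∞ (fun x ↦ b.repr (P (K x (f x))) j) x₀ :=
    h (b.coord j ∘ₗ P)
  refine WSmoothAt.of_basis b fun i ↦ ?_
  have hc : ContMDiffAt 𝓘(ℝ, E) 𝓘(ℝ, ℝ) ∞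
      (fun x ↦ ((M x).updateCol i (b.repr (P (K x (f x))))).det) x₀ := by
    refine contMDiffAt_det fun k j ↦ ?_
    by_cases hj : j = i
    · subst hj; simpa using hy k
    · simpa [Matrix.updateCol_apply, hj] using hM k j
  refine ((hdet.inv₀ h0).mul hc).congr_of_eventuallyEq ?_
  filter_upwards [hne] with x hx
  have e1 : (M x).mulVec (b.repr (f x)) = b.repr (P (K x (f x))) :=
    LinearMap.toMatrix_mulVec_repr b b (P ∘ₗ K x) (f x)
  have e2 : (M x).det * b.repr (f x) i = ((M x).updateCol i (b.repr (P (K x (f x))))).det := by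
    rw [← Matrix.cramer_apply, ← e1, Matrix.cramer_eq_adjugate_mulVec, Matrix.mulVec_mulVec,
      Matrix.adjugate_mul, Matrix.smul_mulVec, Matrix.one_mulVec]
    rfl
  change b.coord i (f x) = (M x).det⁻¹ * ((M x).updateCol i (b.repr (P (K x (f x))))).det
  rw [← e2, Basis.coord_apply]
  field_simp

end WeakSmoothness

/-! ### Smooth fields of forms in local trivializations -/

section SmoothFields

set_option linter.unusedSectionVars false

variable {E : Type*} [NormedAddCommGroup E] [NormedSpace ℝ E] [FiniteDimensional ℝ E]
  {S : Type*} [TopologicalSpace S] [ChartedSpace E S] [IsManifold 𝓘(ℝ, E) ∞ S]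
  {F : Type*} [NormedAddCommGroup F] [NormedSpace ℝ F] [FiniteDimensional ℝ F]
  {V : S → Type*} [TopologicalSpace (TotalSpace F V)]
  [∀ x, AddCommGroup (V x)] [∀ x, Module ℝ (V x)] [∀ x, TopologicalSpace (V x)]
  [∀ x, IsTopologicalAddGroup (V x)] [∀ x, ContinuousSMul ℝ (V x)]
  [FiberBundle F V] [VectorBundle ℝ F V] [ContMDiffVectorBundle ∞ F V 𝓘(ℝ, E)]

variable (E) in
/-- The preferred trivialization of the tangent bundle at `x₀`. -/
abbrev tanTriv (x₀ : S) : Trivialization E (π E (TangentSpace 𝓘(ℝ, E) : S → Type _)) :=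
  trivializationAt E (TangentSpace 𝓘(ℝ, E) : S → Type _) x₀

variable (E F V) in
/-- The algebra homomorphism which reads forms in the preferred trivializations at `x₀`. -/
def chartMap (x₀ x : S) : FormFibre E V x →ₐ[ℝ] Ext E F :=
  ExteriorAlgebra.map (coordMap E F V x₀ x)

theorem chartMap_cv (x₀ x : S) (ξ : Dual ℝ (TangentSpace 𝓘(ℝ, E) x)) :
    chartMap E F V x₀ x (cv _ (V x) ξ) = cv E F (ξ ∘ₗ (tanTriv E x₀).symmₗ ℝ x) := by
  refine (ExteriorAlgebra.map_apply_ι _ _).trans ?_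
  simp only [coordMap, cv, LinearMap.comp_apply, LinearMap.prodMap_apply, LinearMap.inl_apply,
    map_zero]
  rfl

theorem chartMap_vc (x₀ x : S) (v : V x) :
    chartMap E F V x₀ x (vc (TangentSpace 𝓘(ℝ, E) x) (V x) v) =
      vc E F ((trivializationAt F V x₀).linearMapAt ℝ x v) := by
  refine (ExteriorAlgebra.map_apply_ι _ _).trans ?_
  simp only [coordMap, vc, LinearMap.comp_apply, LinearMap.prodMap_apply, LinearMap.inr_apply,
    map_zero]

theorem chartMap_mem_bideg (x₀ : S) {x : S} {i j : ℕ} {X : FormFibre E V x}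
    (hX : X ∈ bidegree E V i j x) : chartMap E F V x₀ x X ∈ bideg E F i j := by
  have h1 : (LinearMap.range (covec E V x)).map (chartMap E F V x₀ x).toLinearMap ≤
      LinearMap.range (cv E F) := by
    rintro _ ⟨_, ⟨ξ, rfl⟩, rfl⟩
    exact ⟨_, (chartMap_cv x₀ x ξ).symm⟩
  have h2 : (LinearMap.range (vec E V x)).map (chartMap E F V x₀ x).toLinearMap ≤
      LinearMap.range (vc E F) := by
    rintro _ ⟨_, ⟨v, rfl⟩, rfl⟩
    exact ⟨_, (chartMap_vc x₀ x v).symm⟩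
  have h3 : (bidegree E V i j x).map (chartMap E F V x₀ x).toLinearMap ≤ bideg E F i j := by
    rw [bidegree, Submodule.map_mul, Submodule.map_pow, Submodule.map_pow]
    exact mul_le_mul' (pow_le_pow_left' h1 _) (pow_le_pow_left' h2 _)
  exact h3 ⟨X, hX, rfl⟩

theorem isSmoothField_iff {α : FormField E V} : IsSmoothField E F V α ↔
    ∀ x₀, WSmoothAt E (fun x ↦ chartMap E F V x₀ x (α x)) x₀ := Iff.rfl

theorem IsSmoothField.mul {α β : FormField E V} (hα : IsSmoothField E F V α)
    (hβ : IsSmoothField E F V β) : IsSmoothField E F V (α * β) :=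
  isSmoothField_iff.mpr fun x₀ ↦ by
    simp only [Pi.mul_apply, map_mul]
    exact (isSmoothField_iff.mp hα x₀).map₂ (isSmoothField_iff.mp hβ x₀) (LinearMap.mul ℝ _)

theorem IsSmoothField.sub {α β : FormField E V} (hα : IsSmoothField E F V α)
    (hβ : IsSmoothField E F V β) : IsSmoothField E F V (α - β) := fun x₀ l ↦ by
  simp only [Pi.sub_apply, map_sub]
  exact (hα x₀ l).sub (hβ x₀ l)

theorem IsSmoothField.neg {α : FormField E V} (hα : IsSmoothField E F V α) :
    IsSmoothField E F V (-α) := fun x₀ l ↦ by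
  simp only [Pi.neg_apply, map_neg]
  exact (hα x₀ l).neg

theorem IsSmoothField.one : IsSmoothField E F V 1 :=
  isSmoothField_iff.mpr fun x₀ ↦ by
    simp only [Pi.one_apply, map_one]
    exact wsmoothAt_const 1

theorem IsSmoothField.pow {α : FormField E V} (hα : IsSmoothField E F V α) (k : ℕ) :
    IsSmoothField E F V (α ^ k) := by
  induction k with
  | zero => rw [pow_zero]; exact IsSmoothField.one
  | succ k ih => rw [pow_succ]; exact ih.mul hα

theorem mul_mem_Omega {i j k l : ℕ} {α β : FormField E V} (hα : α ∈ Omega E F V i j)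
    (hβ : β ∈ Omega E F V k l) : α * β ∈ Omega E F V (i + k) (j + l) :=
  ⟨fun x ↦ mul_mem_bideg (hα.1 x) (hβ.1 x), hα.2.mul hβ.2⟩

theorem mem_tanTriv (x₀ : S) : ∀ᶠ x in nhds x₀, x ∈ (tanTriv E x₀).baseSet :=
  (tanTriv E x₀).open_baseSet.mem_nhds (FiberBundle.mem_baseSet_trivializationAt' x₀)

variable (F V) in
theorem mem_trivializationAt (x₀ : S) :
    ∀ᶠ x in nhds x₀, x ∈ (trivializationAt F V x₀).baseSet :=
  (trivializationAt F V x₀).open_baseSet.mem_nhds (FiberBundle.mem_baseSet_trivializationAt' x₀)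

/-- The coordinate frame at `x` induced by the preferred trivialization at `x₀`. -/
def tanBasis {x₀ x : S} (hx : x ∈ (tanTriv E x₀).baseSet) :
    Basis (Fin (finrank ℝ E)) ℝ (TangentSpace 𝓘(ℝ, E) x) :=
  (tanTriv E x₀).basisAt (finBasis ℝ E) hx

theorem coord_tanBasis {x₀ x : S} (hx : x ∈ (tanTriv E x₀).baseSet) (μ) :
    (tanBasis hx).coord μ ∘ₗ (tanTriv E x₀).symmₗ ℝ x = (finBasis ℝ E).coord μ := by
  ext u
  simp only [LinearMap.comp_apply, Trivialization.symmₗ_apply _ hx, Basis.coord_apply, tanBasis,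
    Trivialization.basisAt, Basis.map_repr, LinearEquiv.trans_apply, LinearEquiv.symm_symm,
    Trivialization.linearEquivAt_apply]
  rw [Trivialization.apply_mk_symm _ hx]

/-- The coordinate vector fields of the preferred trivialization at `x₀`. -/
abbrev tanFrame (x₀ : S) (μ : Fin (finrank ℝ E)) (x : S) : TangentSpace 𝓘(ℝ, E) x :=
  (tanTriv E x₀).localFrame (finBasis ℝ E) μ x

theorem tanFrame_eq {x₀ x : S} (hx : x ∈ (tanTriv E x₀).baseSet) (μ) :
    tanFrame x₀ μ x = tanBasis hx μ :=
  Trivialization.localFrame_apply_of_mem_baseSet _ _ hx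

theorem contMDiffOn_tanFrame (x₀ : S) (μ) :
    ContMDiffOn 𝓘(ℝ, E) (𝓘(ℝ, E).prod 𝓘(ℝ, E)) ∞
      (fun x ↦ TotalSpace.mk' E x (tanFrame x₀ μ x : TangentSpace 𝓘(ℝ, E) x))
      (tanTriv E x₀).baseSet :=
  (tanTriv E x₀).contMDiffOn_localFrame_baseSet ∞ (finBasis ℝ E) μ

theorem contMDiffAt_tanFrame {x₀ x : S} (hx : x ∈ (tanTriv E x₀).baseSet) (μ) :
    ContMDiffAt 𝓘(ℝ, E) (𝓘(ℝ, E).prod 𝓘(ℝ, E)) ∞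
      (fun x ↦ TotalSpace.mk' E x (tanFrame x₀ μ x : TangentSpace 𝓘(ℝ, E) x)) x :=
  contMDiffAt_localFrame_of_mem ∞ _ (finBasis ℝ E) μ hx

/-- A section which is smooth at `x₀` reads as a smooth function. -/
theorem wsmoothAt_section {s : (x : S) → V x} {x₀ : S}
    (hs : ContMDiffAt 𝓘(ℝ, E) (𝓘(ℝ, E).prod 𝓘(ℝ, F)) ∞ (fun x ↦ TotalSpace.mk' F x (s x)) x₀) :
    WSmoothAt E (fun x ↦ (trivializationAt F V x₀).linearMapAt ℝ x (s x)) x₀ := by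
  rw [contMDiffAt_section] at hs
  refine (ContMDiffAt.wsmoothAt hs).congr ?_
  filter_upwards [mem_trivializationAt F V x₀] with x hx
  rw [Trivialization.coe_linearMapAt_of_mem _ hx]

/-- The coframe as a linear map on the fibre at `x`. -/
abbrev coframeAt (e : BoundaryCoframe E F V) (x : S) : TangentSpace 𝓘(ℝ, E) x →ₗ[ℝ] V x :=
  (e.toFun x : TangentSpace 𝓘(ℝ, E) x →ₗ[ℝ] V x)

theorem contMDiffAt_coframe_apply (e : BoundaryCoframe E F V) {x : S}
    {s : (x : S) → TangentSpace 𝓘(ℝ, E) x}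
    (hs : ContMDiffAt 𝓘(ℝ, E) (𝓘(ℝ, E).prod 𝓘(ℝ, E)) ∞ (fun x ↦ TotalSpace.mk' E x (s x)) x) :
    ContMDiffAt 𝓘(ℝ, E) (𝓘(ℝ, E).prod 𝓘(ℝ, F)) ∞
      (fun x ↦ TotalSpace.mk' F x (e.toFun x (s x))) x :=
  (e.contMDiff x).clm_bundle_apply hs

theorem cof_basis_change {T W κ κ' : Type*} [AddCommGroup T] [Module ℝ T] [AddCommGroup W]
    [Module ℝ W] [Fintype κ] [Fintype κ'] (b : Basis κ ℝ T) (b' : Basis κ' ℝ T) (e : T →ₗ[ℝ] W) :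
    cof b e = cof b' e :=
  sum_basis_change b b' (vc T W ∘ₗ e)

theorem coframeForm_eq (e : BoundaryCoframe E F V) {κ : Type*} [Fintype κ] {x : S}
    (b : Basis κ ℝ (TangentSpace 𝓘(ℝ, E) x)) : coframeForm e x = cof b (coframeAt e x) :=
  cof_basis_change _ _ _

theorem coframeForm_mem (e : BoundaryCoframe E F V) : coframeForm e ∈ Omega E F V 1 1 := by
  refine ⟨fun x ↦ cof_mem_bideg _ (coframeAt e x), isSmoothField_iff.mpr fun x₀ ↦ ?_⟩
  have h (μ) : WSmoothAt E (fun x ↦ cv E F ((finBasis ℝ E).coord μ) *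
      vc E F ((trivializationAt F V x₀).linearMapAt ℝ x (e.toFun x (tanFrame x₀ μ x)))) x₀ :=
    (wsmoothAt_section (contMDiffAt_coframe_apply e (contMDiffAt_tanFrame
      (mem_tanTriv (E := E) x₀).self_of_nhds μ))).map
        (LinearMap.mulLeft ℝ (cv E F ((finBasis ℝ E).coord μ)) ∘ₗ vc E F)
  refine (WSmoothAt.sum (s := Finset.univ) fun μ _ ↦ h μ).congr ?_
  filter_upwards [mem_tanTriv (E := E) x₀] with x hx
  rw [coframeForm_eq e (tanBasis hx), cof, map_sum]
  refine Finset.sum_congr rfl fun μ _ ↦ ?_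
  rw [map_mul, chartMap_cv, chartMap_vc, coord_tanBasis, tanFrame_eq hx,
    ContinuousLinearMap.coe_coe]

theorem transversalForm_mem {e : BoundaryCoframe E F V} (en : TransversalSection E F V e) :
    transversalForm en ∈ Omega E F V 0 1 := by
  refine ⟨fun x ↦ vc_mem_bideg _, isSmoothField_iff.mpr fun x₀ ↦ ?_⟩
  refine ((wsmoothAt_section (en.contMDiff x₀)).map (vc E F)).congr
    (Filter.Eventually.of_forall fun x ↦ ?_)
  exact chartMap_vc _ _ _

/-- If `β γ` and `γ` are smooth and multiplication by `γ` is injective on forms of bidegree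
`(i, j)`, then `β` is smooth. -/
theorem mem_Omega_of_mul {β γ : FormField E V} {i j : ℕ} (hβ : ∀ x, β x ∈ bidegree E V i j x)
    (hγ : IsSmoothField E F V γ) (hβγ : IsSmoothField E F V (β * γ))
    (hinj : ∀ x₀, ∀ X ∈ bideg E F i j, X * chartMap E F V x₀ x₀ (γ x₀) = 0 → X = 0) :
    β ∈ Omega E F V i j := by
  refine ⟨hβ, isSmoothField_iff.mpr fun x₀ ↦ ?_⟩
  -- `L` sends γ to the operator X ↦ X γ on the fixed model space of bidegree (i, j), so that β
  -- solves a smooth linear system.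
  let L : Ext E F →ₗ[ℝ] (bideg E F i j →ₗ[ℝ] Ext E F) :=
    LinearMap.lcomp ℝ _ (bideg E F i j).subtype ∘ₗ (LinearMap.mul ℝ (Ext E F)).flip
  have hK := (isSmoothField_iff.mp hγ x₀).map L
  have := WSmoothAt.of_injective hK (f := fun x ↦ ⟨_, chartMap_mem_bideg x₀ (hβ x)⟩) ?_ ?_
  · exact this.map (bideg E F i j).subtype
  · rw [← LinearMap.ker_eq_bot, LinearMap.ker_eq_bot']
    rintro ⟨X, hX⟩ h
    exact Subtype.ext (hinj x₀ X hX h)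
  · refine (isSmoothField_iff.mp hβγ x₀).congr (Filter.Eventually.of_forall fun x ↦ ?_)
    exact (map_mul (chartMap E F V x₀ x) (β x) (γ x)).symm

end SmoothFields

/-! ### Smooth splitting of forms of bidegree (2, 1) -/

section Decomposition

set_option linter.unusedSectionVars false

variable {E : Type*} [NormedAddCommGroup E] [NormedSpace ℝ E] [FiniteDimensional ℝ E]
  {S : Type*} [TopologicalSpace S] [ChartedSpace E S] [IsManifold 𝓘(ℝ, E) ∞ S]
  {F : Type*} [NormedAddCommGroup F] [NormedSpace ℝ F] [FiniteDimensional ℝ F]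
  {V : S → Type*} [TopologicalSpace (TotalSpace F V)]
  [∀ x, AddCommGroup (V x)] [∀ x, Module ℝ (V x)] [∀ x, TopologicalSpace (V x)]
  [∀ x, IsTopologicalAddGroup (V x)] [∀ x, ContinuousSMul ℝ (V x)]
  [FiberBundle F V] [VectorBundle ℝ F V] [ContMDiffVectorBundle ∞ F V 𝓘(ℝ, E)]

/-- The coframe read in the preferred trivializations at `x₀`. -/
def coframeModel (e : BoundaryCoframe E F V) (x₀ x : S) : E →ₗ[ℝ] F :=
  (trivializationAt F V x₀).linearMapAt ℝ x ∘ₗ coframeAt e x ∘ₗ (tanTriv E x₀).symmₗ ℝ x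

theorem chartMap_coframeForm (e : BoundaryCoframe E F V) {x₀ x : S}
    (hx : x ∈ (tanTriv E x₀).baseSet) :
    chartMap E F V x₀ x (coframeForm e x) = cof (finBasis ℝ E) (coframeModel e x₀ x) := by
  rw [coframeForm_eq e (tanBasis hx), cof, map_sum]
  refine Finset.sum_congr rfl fun μ _ ↦ ?_
  rw [map_mul, chartMap_cv, chartMap_vc, coord_tanBasis]
  simp only [coframeModel, LinearMap.comp_apply, Trivialization.symmₗ_apply _ hx]
  rfl

theorem nonempty_splitting_coframe (hd : finrank ℝ E + 1 = finrank ℝ F)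
    {e : BoundaryCoframe E F V} (en : TransversalSection E F V e) (x : S) :
    Nonempty (Splitting (coframeAt e x) (en.toFun x)) := by
  let σ := (trivializationAt F V x).linearEquivAt ℝ x
    (FiberBundle.mem_baseSet_trivializationAt' x)
  have : FiniteDimensional ℝ (V x) := Module.Finite.equiv σ.symm
  have : FiniteDimensional ℝ (TangentSpace 𝓘(ℝ, E) x) := inferInstanceAs (FiniteDimensional ℝ E)
  refine nonempty_splitting (e.injective x) (en.transversal x) ?_
  rw [σ.finrank_eq, ← hd]
  rfl

theorem nonempty_splitting_model (hd : finrank ℝ E + 1 = finrank ℝ F)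
    {e : BoundaryCoframe E F V} (en : TransversalSection E F V e) (x : S) :
    Nonempty (Splitting (coframeModel e x x)
      ((trivializationAt F V x).linearMapAt ℝ x (en.toFun x))) := by
  have hV : x ∈ (trivializationAt F V x).baseSet := FiberBundle.mem_baseSet_trivializationAt' x
  have hT : x ∈ (tanTriv E x).baseSet := FiberBundle.mem_baseSet_trivializationAt' x
  have hσ : Function.Injective ((trivializationAt F V x).linearMapAt ℝ x) := by
    rw [Trivialization.linearMapAt_def_of_mem _ hV]
    exact ((trivializationAt F V x).linearEquivAt ℝ x hV).injective
  refine nonempty_splitting (fun u w h ↦ ?_) ?_ hd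
  · have h1 := e.injective x (hσ h)
    have h2 := congrArg ((tanTriv E x).linearMapAt ℝ x) h1
    rwa [Trivialization.linearMapAt_symmₗ _ hT, Trivialization.linearMapAt_symmₗ _ hT] at h2
  · rintro ⟨u, hu⟩
    exact en.transversal x ⟨_, hσ hu⟩

theorem commute_coframeForm_pow (e : BoundaryCoframe E F V) (k : ℕ) (α : FormField E V) :
    Commute (coframeForm e ^ k) α :=
  funext fun x ↦ commute_cof_pow (tangentBasis x) (coframeAt e x) k (α x)

/-- Every form of bidegree `(2, 1)` is the sum of an element of the kernel of `W_{N-3}` and of a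
form `e α + β e_n`. -/
theorem exists_smooth_decomposition (hd : finrank ℝ E + 1 = finrank ℝ F)
    {e : BoundaryCoframe E F V} (en : TransversalSection E F V e) {k : ℕ}
    (hk : k + 2 = finrank ℝ E) {Y : FormField E V} (hY : Y ∈ Omega E F V 2 1) :
    ∃ α ∈ Omega E F V 1 0, ∃ β ∈ Omega E F V 2 0,
      coframeForm e ^ k * (Y - coframeForm e * α - β * transversalForm en) = 0 := by
  have hk' : k + 2 = Fintype.card (Fin (finrank ℝ E)) := by rw [hk, Fintype.card_fin]
  -- The choice at each point is arbitrary a priori; smoothness follows because α and then β solve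
  -- injective linear equations with smooth data.
  have hp (x : S) := exists_decomposition (b := tangentBasis x)
    (nonempty_splitting_coframe hd en x).some hk' (hY.1 x)
  choose ξ β hβ h using hp
  let α : FormField E V := fun x ↦ cv _ _ (ξ x)
  have hdec : coframeForm e ^ k * (Y - coframeForm e * α - β * transversalForm en) = 0 :=
    funext h
  have hα0 (x) : α x ∈ bidegree E V 1 0 x := cv_mem_bideg _
  have hβn : β * transversalForm en = transversalForm en * β :=
    funext fun x ↦ vc_mul_comm (hβ x) (en.toFun x)
  have hαn : α * transversalForm en = -(transversalForm en * α) :=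
    funext fun x ↦ cv_mul_vc _ _
  have hnn : transversalForm en * transversalForm en = 0 := funext fun x ↦ vc_mul_self _
  have hc (j : ℕ) (γ : FormField E V) := (commute_coframeForm_pow e j γ).eq
  -- Multiplication by e_n kills β e_n and leaves an equation for α alone.
  have e1 : α * (transversalForm en * coframeForm e ^ (k + 1)) =
      -(transversalForm en * coframeForm e ^ k * Y) := by
    have h1 : transversalForm en * (coframeForm e ^ k * (β * transversalForm en)) = 0 := by
      rw [hβn, hc, mul_assoc (transversalForm en) β, ← mul_assoc, hnn, zero_mul]
    have := congrArg (transversalForm en * ·) hdec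
    simp only [mul_sub, mul_zero, h1, sub_zero, sub_eq_zero] at this
    rw [mul_assoc _ _ Y, this, ← mul_assoc, hαn, neg_mul, mul_assoc _ α, ← hc, pow_succ]
    simp only [mul_assoc]
  have hsn := (transversalForm_mem en).2
  have hse := (coframeForm_mem e).2
  have hα : α ∈ Omega E F V 1 0 := by
    refine mem_Omega_of_mul hα0 (hsn.mul (hse.pow (k + 1))) ?_ fun x₀ X hX h0 ↦ ?_
    · rw [e1]
      exact ((hsn.mul (hse.pow k)).mul hY.2).neg
    · obtain ⟨s⟩ := nonempty_splitting_model hd en x₀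
      refine cv_eq_zero_of_vc_mul (b := finBasis ℝ E) (k := k + 1) s (by omega) hX ?_
      rw [← h0, Pi.mul_apply, Pi.pow_apply, map_mul, map_pow,
        chartMap_coframeForm e (mem_tanTriv (E := E) x₀).self_of_nhds]
      exact congrArg (fun z ↦ X * (z * _)) (chartMap_vc x₀ x₀ (en.toFun x₀)).symm
  refine ⟨α, hα, β, ?_, hdec⟩
  -- Now that α is smooth, the decomposition is itself an equation for β.
  have e2 : β * (transversalForm en * coframeForm e ^ k) =
      coframeForm e ^ k * Y - coframeForm e ^ k * coframeForm e * α := by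
    rw [mul_sub, mul_sub, sub_eq_zero] at hdec
    rw [← mul_assoc, ← hc, ← hdec, ← mul_assoc]
  refine mem_Omega_of_mul hβ (hsn.mul (hse.pow k)) ?_ fun x₀ X hX h0 ↦ ?_
  · rw [e2]
    exact ((hse.pow k).mul hY.2).sub (((hse.pow k).mul hse).mul hα.2)
  · obtain ⟨s⟩ := nonempty_splitting_model hd en x₀
    refine eq_zero_of_mul_vc (b := finBasis ℝ E) (k := k) s hk' hX ?_
    rw [← h0, Pi.mul_apply, Pi.pow_apply, map_mul, map_pow,
      chartMap_coframeForm e (mem_tanTriv (E := E) x₀).self_of_nhds]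
    exact congrArg (fun z ↦ X * (z * _)) (chartMap_vc x₀ x₀ (en.toFun x₀)).symm

end Decomposition

/-! ### The map ϱ on smooth fields -/

section Bracket

theorem map_contractRight {R M N : Type*} [CommRing R] [AddCommGroup M] [Module R M]
    [AddCommGroup N] [Module R N] (f : M →ₗ[R] N) (d : Dual R N) (X : ExteriorAlgebra R M) :
    ExteriorAlgebra.map f (CliffordAlgebra.contractRight X (d ∘ₗ f)) =
      CliffordAlgebra.contractRight (ExteriorAlgebra.map f X) d := by
  induction X using CliffordAlgebra.right_induction with
  | algebraMap r =>
    rw [CliffordAlgebra.contractRight_algebraMap, map_zero, AlgHom.commutes]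
    exact (CliffordAlgebra.contractRight_algebraMap (Q := (0 : QuadraticForm R N)) d r).symm
  | add x y hx hy => simp only [map_add, LinearMap.add_apply, hx, hy]
  | mul_ι m x hx =>
    have h1 : ExteriorAlgebra.map f (CliffordAlgebra.ι 0 m) = CliffordAlgebra.ι 0 (f m) :=
      ExteriorAlgebra.map_apply_ι f m
    rw [CliffordAlgebra.contractRight_mul_ι, map_sub, map_smul, map_mul, map_mul, h1, hx]
    exact (CliffordAlgebra.contractRight_mul_ι _ _ _).symm

theorem brk_basis_change {T W κ κ' : Type*} [AddCommGroup T] [Module ℝ T] [AddCommGroup W]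
    [Module ℝ W] [Fintype κ] [Fintype κ'] (b : Basis κ ℝ T) (b' : Basis κ' ℝ T) (e : T →ₗ[ℝ] W)
    (g : W →ₗ[ℝ] Dual ℝ W) (X : Ext T W) : brk b e g X = brk b' e g X := by
  rw [brk_apply, brk_apply]
  exact congrArg Neg.neg (sum_basis_change b b' (CliffordAlgebra.contractRight X ∘ₗ
    LinearMap.lcomp ℝ ℝ (LinearMap.snd ℝ (Dual ℝ T) W) ∘ₗ g ∘ₗ e))

set_option linter.unusedSectionVars false

variable {E : Type*} [NormedAddCommGroup E] [NormedSpace ℝ E] [FiniteDimensional ℝ E]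
  {S : Type*} [TopologicalSpace S] [ChartedSpace E S] [IsManifold 𝓘(ℝ, E) ∞ S]
  {F : Type*} [NormedAddCommGroup F] [NormedSpace ℝ F] [FiniteDimensional ℝ F]
  {V : S → Type*} [TopologicalSpace (TotalSpace F V)]
  [∀ x, AddCommGroup (V x)] [∀ x, Module ℝ (V x)] [∀ x, TopologicalSpace (V x)]
  [∀ x, IsTopologicalAddGroup (V x)] [∀ x, ContinuousSMul ℝ (V x)]
  [FiberBundle F V] [VectorBundle ℝ F V] [ContMDiffVectorBundle ∞ F V 𝓘(ℝ, E)]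

/-- The map `V_x → V_x^*` given by the fibre metric. -/
def flatMap (η : LorentzMetric E F V) (x : S) : V x →ₗ[ℝ] Dual ℝ (V x) :=
  ContinuousLinearMap.coeLM ℝ ∘ₗ (η.inner x : V x →ₗ[ℝ] V x →L[ℝ] ℝ)

theorem rho_apply (η : LorentzMetric E F V) (e : BoundaryCoframe E F V) (X : FormField E V)
    (x : S) : rho η e X x = brk (tangentBasis x) (coframeAt e x) (flatMap η x) (X x) := by
  rw [brk_apply]
  refine congrArg Neg.neg (Finset.sum_congr rfl fun ν _ ↦ ?_)
  rfl

theorem chartMap_cinR {x₀ x : S} (hx : x ∈ (trivializationAt F V x₀).baseSet) (d : Dual ℝ (V x))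
    (X : FormFibre E V x) : chartMap E F V x₀ x (cinR _ d X) =
      cinR E (d ∘ₗ (trivializationAt F V x₀).symmₗ ℝ x) (chartMap E F V x₀ x X) := by
  have h := map_contractRight (coordMap E F V x₀ x)
    ((d ∘ₗ (trivializationAt F V x₀).symmₗ ℝ x) ∘ₗ LinearMap.snd ℝ _ _) X
  have h1 : ((d ∘ₗ (trivializationAt F V x₀).symmₗ ℝ x) ∘ₗ LinearMap.snd ℝ _ _) ∘ₗ
      coordMap E F V x₀ x = d ∘ₗ LinearMap.snd ℝ _ _ := by
    refine LinearMap.ext fun p ↦ ?_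
    simp only [coordMap, LinearMap.comp_apply, LinearMap.snd_apply, LinearMap.prodMap_apply]
    rw [Trivialization.symmₗ_linearMapAt _ hx]
  rw [h1] at h
  exact h

theorem contMDiffAt_inner (η : LorentzMetric E F V) {s t : (x : S) → V x} {x : S}
    (hs : ContMDiffAt 𝓘(ℝ, E) (𝓘(ℝ, E).prod 𝓘(ℝ, F)) ∞ (fun x ↦ TotalSpace.mk' F x (s x)) x)
    (ht : ContMDiffAt 𝓘(ℝ, E) (𝓘(ℝ, E).prod 𝓘(ℝ, F)) ∞ (fun x ↦ TotalSpace.mk' F x (t x)) x) :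
    ContMDiffAt 𝓘(ℝ, E) 𝓘(ℝ, ℝ) ∞ (fun x ↦ η.inner x (s x) (t x)) x := by
  have : ContMDiffAt 𝓘(ℝ, E) (𝓘(ℝ, E).prod 𝓘(ℝ, ℝ)) ∞
      (fun m ↦ TotalSpace.mk' ℝ (E := Bundle.Trivial S ℝ) m (η.inner m (s m) (t m))) x :=
    ContMDiffAt.clm_bundle_apply₂ (F₁ := F) (F₂ := F) (η.contMDiff x) hs ht
  rw [contMDiffAt_totalSpace] at this
  exact this.2

theorem cinR_bideg {T W : Type*} [AddCommGroup T] [Module ℝ T] [AddCommGroup W] [Module ℝ W]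
    (d : Dual ℝ W) {X : Ext T W} (hX : X ∈ bideg T W 1 2) : cinR T d X ∈ bideg T W 1 1 := by
  refine bideg_one_two_le (P := (bideg T W 1 1).comap (cinR T d)) (fun ξ w w' ↦ ?_) hX
  rw [Submodule.mem_comap, cinR_cv_vc_vc]
  exact (mul_mem_bideg (cv_mem_bideg ξ) (vc_mem_bideg (T := T) (d w' • w - d w • w')) : )

theorem brk_mem_bideg {T W κ : Type*} [AddCommGroup T] [Module ℝ T] [AddCommGroup W] [Module ℝ W]
    [Fintype κ] (b : Basis κ ℝ T) (e : T →ₗ[ℝ] W) (g : W →ₗ[ℝ] Dual ℝ W) {X : Ext T W}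
    (hX : X ∈ bideg T W 1 2) : brk b e g X ∈ bideg T W 2 1 := by
  rw [brk_apply]
  refine Submodule.neg_mem _ (Submodule.sum_mem _ fun ν _ ↦ ?_)
  exact (mul_mem_bideg (cv_mem_bideg _) (cinR_bideg _ hX) : )

theorem rho_mem (η : LorentzMetric E F V) (e : BoundaryCoframe E F V) {X : FormField E V}
    (hX : X ∈ Omega E F V 1 2) : rho η e X ∈ Omega E F V 2 1 := by
  refine ⟨fun x ↦ ?_, isSmoothField_iff.mpr fun x₀ ↦ ?_⟩
  · rw [rho_apply]
    exact brk_mem_bideg _ _ _ (hX.1 x)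
  let σ := trivializationAt F V x₀
  let d (μ) (x : S) : Dual ℝ F := flatMap η x (e.toFun x (tanFrame x₀ μ x)) ∘ₗ σ.symmₗ ℝ x
  have hd (μ) : WSmoothAt E (d μ) x₀ := by
    refine WSmoothAt.of_basis (finBasis ℝ F).dualBasis fun i ↦ ?_
    have h1 := contMDiffAt_inner η (contMDiffAt_coframe_apply e (contMDiffAt_tanFrame
      (mem_tanTriv (E := E) x₀).self_of_nhds μ)) (contMDiffAt_localFrame_of_mem ∞ σ
        (finBasis ℝ F) i (mem_trivializationAt F V x₀).self_of_nhds)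
    refine h1.congr_of_eventuallyEq ?_
    filter_upwards [mem_trivializationAt F V x₀] with x hx
    rw [Trivialization.localFrame_apply_of_mem_baseSet _ _ hx, Basis.coord_apply,
      Basis.dualBasis_repr]
    have h2 : σ.symmₗ ℝ x (finBasis ℝ F i) = σ.basisAt (finBasis ℝ F) hx i := by
      rw [Trivialization.symmₗ_apply _ hx, Trivialization.basisAt, Basis.map_apply]
      rfl
    simp only [d, LinearMap.comp_apply, h2]
    rfl
  let L : Dual ℝ F →ₗ[ℝ] Ext E F →ₗ[ℝ] Ext E F :=
    CliffordAlgebra.contractRight.flip ∘ₗ LinearMap.lcomp ℝ ℝ (LinearMap.snd ℝ (Dual ℝ E) F)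
  have h (μ) : WSmoothAt E (fun x ↦ cv E F ((finBasis ℝ E).coord μ) *
      cinR E (d μ x) (chartMap E F V x₀ x (X x))) x₀ :=
    ((hd μ).map₂ (isSmoothField_iff.mp hX.2 x₀) L).map
      (LinearMap.mulLeft ℝ (cv E F ((finBasis ℝ E).coord μ)))
  refine ((WSmoothAt.sum (s := Finset.univ) fun μ _ ↦ h μ).map (-LinearMap.id)).congr ?_
  filter_upwards [mem_tanTriv (E := E) x₀, mem_trivializationAt F V x₀] with x hx hx'
  rw [rho_apply, brk_basis_change _ (tanBasis hx), brk_apply, map_neg, map_sum]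
  refine congrArg Neg.neg (Finset.sum_congr rfl fun μ _ ↦ ?_)
  rw [map_mul, chartMap_cv, chartMap_cinR hx', coord_tanBasis]
  simp only [d, tanFrame_eq hx]
  rfl

theorem rho_mem_kerW (η : LorentzMetric E F V) (e : BoundaryCoframe E F V) {k : ℕ}
    {X : FormField E V} (hX : X ∈ kerW e k 1 2) : rho η e X ∈ kerW e k 2 1 := by
  refine ⟨rho_mem η e hX.1, LinearMap.mem_ker.mpr (funext fun x ↦ ?_)⟩
  have h : (X * coframeForm e ^ k) x = 0 := congrFun (LinearMap.mem_ker.mp hX.2) x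
  change rho η e X x * coframeForm e x ^ k = 0
  rw [rho_apply]
  exact brk_mul_cof_pow _ _ _ (fun s t ↦ η.symm x s t) (hX.1.1 x) h

end Bracket

/-! ### The torsion: tensoriality, smoothness and dependence on ω -/

section Torsion

set_option linter.unusedSectionVars false

variable {E : Type*} [NormedAddCommGroup E] [NormedSpace ℝ E] [FiniteDimensional ℝ E]
  {S : Type*} [TopologicalSpace S] [ChartedSpace E S] [IsManifold 𝓘(ℝ, E) ∞ S]
  {F : Type*} [NormedAddCommGroup F] [NormedSpace ℝ F] [FiniteDimensional ℝ F]
  {V : S → Type*} [TopologicalSpace (TotalSpace F V)]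
  [∀ x, AddCommGroup (V x)] [∀ x, Module ℝ (V x)] [∀ x, TopologicalSpace (V x)]
  [∀ x, IsTopologicalAddGroup (V x)] [∀ x, ContinuousSMul ℝ (V x)]
  [FiberBundle F V] [VectorBundle ℝ F V] [ContMDiffVectorBundle ∞ F V 𝓘(ℝ, E)]

/-- `∇_X (e Y) - ∇_Y (e X) - e [X, Y]`. -/
def torsionAux (e : BoundaryCoframe E F V) (ω₀ : CovariantDerivative 𝓘(ℝ, E) F V) (x : S)
    (X Y : (y : S) → TangentSpace 𝓘(ℝ, E) y) : V x :=
  ω₀ (fun y ↦ e.toFun y (Y y)) x (X x) - ω₀ (fun y ↦ e.toFun y (X y)) x (Y x)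
    - e.toFun x (VectorField.mlieBracket 𝓘(ℝ, E) X Y x)

theorem torsionAux_swap (e : BoundaryCoframe E F V) (ω₀ : CovariantDerivative 𝓘(ℝ, E) F V) (x : S)
    (X Y : (y : S) → TangentSpace 𝓘(ℝ, E) y) :
    torsionAux e ω₀ x X Y = -torsionAux e ω₀ x Y X := by
  rw [torsionAux, torsionAux, VectorField.mlieBracket_swap_apply, map_neg]
  abel

theorem mdifferentiableAt_coframe_apply (e : BoundaryCoframe E F V) {x : S}
    {s : (x : S) → TangentSpace 𝓘(ℝ, E) x}
    (hs : MDifferentiableAt 𝓘(ℝ, E) (𝓘(ℝ, E).prod 𝓘(ℝ, E)) (fun x ↦ TotalSpace.mk' E x (s x)) x) :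
    MDifferentiableAt 𝓘(ℝ, E) (𝓘(ℝ, E).prod 𝓘(ℝ, F))
      (fun x ↦ TotalSpace.mk' F x (e.toFun x (s x))) x :=
  ((e.contMDiff x).mdifferentiableAt (by simp)).clm_bundle_apply hs

/-- For f X in place of X, the Leibniz term −(Yf) eX of −∇_Y(e f X) cancels against the one from
−e[fX, Y]. -/
theorem tensorialAt_torsionAux (e : BoundaryCoframe E F V)
    (ω₀ : CovariantDerivative 𝓘(ℝ, E) F V) (x : S) (Y : (y : S) → TangentSpace 𝓘(ℝ, E) y) :
    TensorialAt 𝓘(ℝ, E) E (fun X ↦ torsionAux e ω₀ x X Y) x where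
  smul {f X} hf hX := by
    have h1 : (fun y ↦ e.toFun y ((f • X) y)) = f • fun y ↦ e.toFun y (X y) :=
      funext fun y ↦ map_smul _ _ _
    have h2 := ω₀.isCovariantDerivativeOnUniv.leibniz (mdifferentiableAt_coframe_apply e hX) hf
    rw [torsionAux, torsionAux, h1, h2, VectorField.mlieBracket_smul_left hf hX]
    simp only [Pi.smul_apply', map_add, map_neg, map_smul, add_apply, smul_apply,
      ContinuousLinearMap.smulRight_apply, neg_smul]
    module
  add {X X'} hX hX' := by
    have h1 : (fun y ↦ e.toFun y ((X + X') y)) =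
        (fun y ↦ e.toFun y (X y)) + fun y ↦ e.toFun y (X' y) :=
      funext fun y ↦ map_add _ _ _
    have h2 := ω₀.isCovariantDerivativeOnUniv.add (mdifferentiableAt_coframe_apply e hX)
      (mdifferentiableAt_coframe_apply e hX')
    rw [torsionAux, torsionAux, torsionAux, h1, h2, VectorField.mlieBracket_add_left hX hX']
    simp only [Pi.add_apply, map_add, add_apply]
    abel

theorem tensorialAt_torsionAux_right (e : BoundaryCoframe E F V)
    (ω₀ : CovariantDerivative 𝓘(ℝ, E) F V) (x : S) (X : (y : S) → TangentSpace 𝓘(ℝ, E) y) :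
    TensorialAt 𝓘(ℝ, E) E (torsionAux e ω₀ x X) x where
  smul {f Y} hf hY := by
    rw [torsionAux_swap, (tensorialAt_torsionAux e ω₀ x X).smul hf hY, torsionAux_swap _ _ _ X,
      smul_neg]
  add {Y Y'} hY hY' := by
    rw [torsionAux_swap, (tensorialAt_torsionAux e ω₀ x X).add hY hY', torsionAux_swap _ _ _ X,
      torsionAux_swap _ _ _ X, neg_add]

/-- The torsion `d_{ω₀} e` at `x`, as a bilinear map. -/
def torsionHom (e : BoundaryCoframe E F V) (ω₀ : CovariantDerivative 𝓘(ℝ, E) F V) (x : S) :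
    TangentSpace 𝓘(ℝ, E) x →L[ℝ] TangentSpace 𝓘(ℝ, E) x →L[ℝ] V x :=
  TensorialAt.mkHom₂ (I := 𝓘(ℝ, E)) (F := E) (F' := E) (torsionAux e ω₀ x) x
    (fun Y _ ↦ tensorialAt_torsionAux e ω₀ x Y) (fun X _ ↦ tensorialAt_torsionAux_right e ω₀ x X)

theorem torsionHom_apply (e : BoundaryCoframe E F V) (ω₀ : CovariantDerivative 𝓘(ℝ, E) F V)
    {x : S} {X Y : (y : S) → TangentSpace 𝓘(ℝ, E) y}
    (hX : MDifferentiableAt 𝓘(ℝ, E) (𝓘(ℝ, E).prod 𝓘(ℝ, E)) (fun x ↦ TotalSpace.mk' E x (X x)) x)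
    (hY : MDifferentiableAt 𝓘(ℝ, E) (𝓘(ℝ, E).prod 𝓘(ℝ, E)) (fun x ↦ TotalSpace.mk' E x (Y x)) x) :
    torsionHom e ω₀ x (X x) (Y x) = torsionAux e ω₀ x X Y :=
  TensorialAt.mkHom₂_apply _ _ hX hY

theorem torsionValue_eq (η : LorentzMetric E F V) (e : BoundaryCoframe E F V)
    (ω₀ : CovariantDerivative 𝓘(ℝ, E) F V) (A : FormField E V) (x : S)
    (u w : TangentSpace 𝓘(ℝ, E) x) : torsionValue η e ω₀ A x u w =
      torsionHom e ω₀ x u w + (act η (A x) u (e.toFun x w) - act η (A x) w (e.toFun x u)) := by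
  have h : torsionHom e ω₀ x u w =
      torsionAux e ω₀ x (FiberBundle.extend E u) (FiberBundle.extend E w) := rfl
  rw [h]
  simp only [torsionValue, covDeriv, torsionAux, FiberBundle.extend_apply_self]
  abel

/-- Smoothness of ω₀ is applied to a global section, so the local section σ is cut off by a bump
function equal to 1 near x₀; locality of the connection then removes the cutoff. -/
theorem contMDiffAt_cov [T2Space S] (ω₀ : CovariantDerivative 𝓘(ℝ, E) F V)
    [CovariantDerivative.ContMDiffCovariantDerivative ω₀ ∞] {U : Set S} (hU : IsOpen U) {x₀ : S}
    (hx₀ : x₀ ∈ U) {σ : (x : S) → V x} (hσ : ContMDiffOn 𝓘(ℝ, E) (𝓘(ℝ, E).prod 𝓘(ℝ, F)) ∞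
      (fun x ↦ TotalSpace.mk' F x (σ x)) U) {X : (x : S) → TangentSpace 𝓘(ℝ, E) x}
    (hX : ContMDiffAt 𝓘(ℝ, E) (𝓘(ℝ, E).prod 𝓘(ℝ, E)) ∞ (fun x ↦ TotalSpace.mk' E x (X x)) x₀) :
    ContMDiffAt 𝓘(ℝ, E) (𝓘(ℝ, E).prod 𝓘(ℝ, F)) ∞
      (fun x ↦ TotalSpace.mk' F x (ω₀ σ x (X x))) x₀ := by
  obtain ⟨ψ, -, hψ⟩ := (SmoothBumpFunction.nhds_basis_tsupport (I := 𝓘(ℝ, E)) x₀).mem_iff.mp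
    (hU.mem_nhds hx₀)
  have h1 : ContMDiff 𝓘(ℝ, E) (𝓘(ℝ, E).prod 𝓘(ℝ, F)) ∞
      (fun x ↦ TotalSpace.mk' F x (((ψ : S → ℝ) • σ) x)) :=
    ContMDiffOn.smul_section_of_tsupport ψ.contMDiff.contMDiffOn hU hψ hσ
  have h2 := (CovariantDerivative.ContMDiffCovariantDerivative.contMDiff (cov := ω₀)
    (k := ∞)).contMDiff (σ := (ψ : S → ℝ) • σ) h1.contMDiffOn x₀ (Set.mem_univ x₀)
  rw [contMDiffWithinAt_univ] at h2
  refine (h2.clm_bundle_apply hX).congr_of_eventuallyEq ?_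
  filter_upwards [hU.mem_nhds hx₀, ψ.eventuallyEq_one.eventually_nhds] with x hx hx'
  rw [ω₀.isCovariantDerivativeOnUniv.congr_of_eventuallyEq (σ' := (ψ : S → ℝ) • σ)
    ((hσ.contMDiffAt (hU.mem_nhds hx)).mdifferentiableAt (by simp))
    (h1.contMDiffAt.mdifferentiableAt (by simp)) Filter.univ_mem]
  filter_upwards [hx'] with y hy
  rw [Pi.smul_apply', hy, Pi.one_apply, one_smul]

theorem contMDiffOn_coframe_apply (e : BoundaryCoframe E F V) {U : Set S}
    {s : (x : S) → TangentSpace 𝓘(ℝ, E) x}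
    (hs : ContMDiffOn 𝓘(ℝ, E) (𝓘(ℝ, E).prod 𝓘(ℝ, E)) ∞ (fun x ↦ TotalSpace.mk' E x (s x)) U) :
    ContMDiffOn 𝓘(ℝ, E) (𝓘(ℝ, E).prod 𝓘(ℝ, F)) ∞
      (fun x ↦ TotalSpace.mk' F x (e.toFun x (s x))) U :=
  fun x hx ↦ (e.contMDiff x).contMDiffWithinAt.clm_bundle_apply (hs x hx)

theorem contMDiffAt_torsionAux [T2Space S] (e : BoundaryCoframe E F V)
    (ω₀ : CovariantDerivative 𝓘(ℝ, E) F V) [CovariantDerivative.ContMDiffCovariantDerivative ω₀ ∞]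
    {U : Set S} (hU : IsOpen U) {x₀ : S} (hx₀ : x₀ ∈ U) {X Y : (x : S) → TangentSpace 𝓘(ℝ, E) x}
    (hX : ContMDiffOn 𝓘(ℝ, E) (𝓘(ℝ, E).prod 𝓘(ℝ, E)) ∞ (fun x ↦ TotalSpace.mk' E x (X x)) U)
    (hY : ContMDiffOn 𝓘(ℝ, E) (𝓘(ℝ, E).prod 𝓘(ℝ, E)) ∞ (fun x ↦ TotalSpace.mk' E x (Y x)) U) :
    ContMDiffAt 𝓘(ℝ, E) (𝓘(ℝ, E).prod 𝓘(ℝ, F)) ∞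
      (fun x ↦ TotalSpace.mk' F x (torsionAux e ω₀ x X Y)) x₀ := by
  have hX₀ := hX.contMDiffAt (hU.mem_nhds hx₀)
  have hY₀ := hY.contMDiffAt (hU.mem_nhds hx₀)
  have h1 := contMDiffAt_cov ω₀ hU hx₀ (contMDiffOn_coframe_apply e hY) hX₀
  have h2 := contMDiffAt_cov ω₀ hU hx₀ (contMDiffOn_coframe_apply e hX) hY₀
  have : IsManifold 𝓘(ℝ, E) (((⊤ : ℕ∞) : ℕ∞ω) + 1) S := inferInstanceAs (IsManifold 𝓘(ℝ, E) ∞ S)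
  have : IsManifold 𝓘(ℝ, E) (minSmoothness ℝ 2) S := by
    rw [minSmoothness_of_isRCLikeNormedField]
    infer_instance
  have h3 := ContMDiffAt.mlieBracket_vectorField (m := ⊤) (n := ⊤) hX₀ hY₀ (by simp)
  exact (h1.sub_section h2).sub_section (contMDiffAt_coframe_apply e h3)

/-- `d_{ω₀} e`. -/
def torsionForm (e : BoundaryCoframe E F V) (ω₀ : CovariantDerivative 𝓘(ℝ, E) F V) :
    FormField E V := fun x ↦
  (1 / 2 : ℝ) • ∑ μ, ∑ ν, cv _ _ ((tangentBasis x).coord μ) *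
    cv _ _ ((tangentBasis x).coord ν) *
      vc _ _ (torsionHom e ω₀ x (tangentBasis x μ) (tangentBasis x ν))

/-- The torsion is affine in the connection, so the structural constraint becomes an affine
condition on v through ϱ(v). -/
theorem dCoframe_eq (η : LorentzMetric E F V) (e : BoundaryCoframe E F V)
    (ω₀ : CovariantDerivative 𝓘(ℝ, E) F V) {A : FormField E V} (hA : A ∈ Omega E F V 1 2) :
    dCoframe η e ω₀ A = torsionForm e ω₀ + rho η e A := by
  funext x
  rw [Pi.add_apply, rho_apply, ← sum_sum_act_eq_brk _ _ _ (hA.1 x), torsionForm, ← smul_add]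
  simp only [← Finset.sum_add_distrib, ← mul_add, ← map_add]
  refine congrArg _ (Finset.sum_congr rfl fun μ _ ↦ Finset.sum_congr rfl fun ν _ ↦ ?_)
  rw [torsionValue_eq]
  rfl

theorem sum_sum_mem_bideg {T W κ : Type*} [AddCommGroup T] [Module ℝ T] [AddCommGroup W]
    [Module ℝ W] [Fintype κ] (b : Basis κ ℝ T) (f : T → T → W) :
    (1 / 2 : ℝ) • ∑ μ, ∑ ν, cv T W (b.coord μ) * cv T W (b.coord ν) * vc T W (f (b μ) (b ν)) ∈
      bideg T W 2 1 :=
  Submodule.smul_mem _ _ (Submodule.sum_mem _ fun μ _ ↦ Submodule.sum_mem _ fun ν _ ↦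
    (mul_mem_bideg (mul_mem_bideg (cv_mem_bideg _) (cv_mem_bideg _))
      (vc_mem_bideg (T := T) (f (b μ) (b ν))) :))

theorem torsionForm_mem [T2Space S] (e : BoundaryCoframe E F V)
    (ω₀ : CovariantDerivative 𝓘(ℝ, E) F V)
    [CovariantDerivative.ContMDiffCovariantDerivative ω₀ ∞] :
    torsionForm e ω₀ ∈ Omega E F V 2 1 := by
  refine ⟨fun x ↦ sum_sum_mem_bideg (tangentBasis x) fun u w ↦ torsionHom e ω₀ x u w,
    isSmoothField_iff.mpr fun x₀ ↦ ?_⟩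
  have h (μ ν) : WSmoothAt E (fun x ↦ cv E F ((finBasis ℝ E).coord μ) *
      cv E F ((finBasis ℝ E).coord ν) * vc E F ((trivializationAt F V x₀).linearMapAt ℝ x
        (torsionAux e ω₀ x (tanFrame x₀ μ) (tanFrame x₀ ν)))) x₀ :=
    (wsmoothAt_section (contMDiffAt_torsionAux e ω₀ (tanTriv E x₀).open_baseSet
      (mem_tanTriv (E := E) x₀).self_of_nhds (contMDiffOn_tanFrame x₀ μ)
        (contMDiffOn_tanFrame x₀ ν))).map (LinearMap.mulLeft ℝ (cv E F ((finBasis ℝ E).coord μ) *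
          cv E F ((finBasis ℝ E).coord ν)) ∘ₗ vc E F)
  refine ((WSmoothAt.sum (s := Finset.univ) fun μ _ ↦ WSmoothAt.sum (s := Finset.univ)
    fun ν _ ↦ h μ ν).map ((1 / 2 : ℝ) • LinearMap.id)).congr ?_
  filter_upwards [mem_tanTriv (E := E) x₀] with x hx
  have hd (μ) := (contMDiffAt_tanFrame hx μ).mdifferentiableAt (by simp)
  have h1 := sum_sum_basis_change (tangentBasis x) (tanBasis hx)
    (ContinuousLinearMap.coeLM ℝ ∘ₗ (torsionHom e ω₀ x : _ →ₗ[ℝ] _ →L[ℝ] V x))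
  simp only [LinearMap.comp_apply, ContinuousLinearMap.coeLM_apply,
    ContinuousLinearMap.coe_coe] at h1
  rw [torsionForm, h1, map_smul, map_sum]
  refine congrArg _ (Finset.sum_congr rfl fun μ _ ↦ ?_)
  rw [map_sum]
  refine Finset.sum_congr rfl fun ν _ ↦ ?_
  rw [map_mul, map_mul, chartMap_cv, chartMap_cv, chartMap_vc, coord_tanBasis, coord_tanBasis,
    ← tanFrame_eq hx, ← tanFrame_eq hx, torsionHom_apply e ω₀ (hd μ) (hd ν)]

theorem dCoframe_mem [T2Space S] (η : LorentzMetric E F V) (e : BoundaryCoframe E F V)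
    (ω₀ : CovariantDerivative 𝓘(ℝ, E) F V)
    [CovariantDerivative.ContMDiffCovariantDerivative ω₀ ∞] {A : FormField E V}
    (hA : A ∈ Omega E F V 1 2) : dCoframe η e ω₀ A ∈ Omega E F V 2 1 := by
  rw [dCoframe_eq η e ω₀ hA]
  exact Submodule.add_mem _ (torsionForm_mem e ω₀) (rho_mem η e hA)

end Torsion

/-! ### Vanishing, orthogonality and uniqueness -/

section Main

/-- `Orthogonal21` speaks only of h-orthonormal bases, so one has to be exhibited before it can be
used. -/
theorem exists_basis_orthonormal {T : Type*} [AddCommGroup T] [Module ℝ T] [FiniteDimensional ℝ T]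
    (B : T →ₗ[ℝ] T →ₗ[ℝ] ℝ) (hs : ∀ u w, B u w = B w u) (hp : ∀ u, u ≠ 0 → 0 < B u u) :
    ∃ b : Basis (Fin (finrank ℝ T)) ℝ T, ∀ i j, B (b i) (b j) = if i = j then 1 else 0 := by
  obtain ⟨v, hv⟩ := LinearMap.BilinForm.exists_orthogonal_basis (B := B) ⟨hs⟩
  have h0 (i) : 0 < B (v i) (v i) := hp _ (v.ne_zero i)
  have hu (i) : IsUnit (√(B (v i) (v i)))⁻¹ := by
    rw [isUnit_iff_ne_zero]
    exact inv_ne_zero (Real.sqrt_pos.mpr (h0 i)).ne'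
  refine ⟨v.isUnitSMul hu, fun i j ↦ ?_⟩
  simp only [Basis.isUnitSMul_apply, map_smul, LinearMap.smul_apply, smul_eq_mul]
  split_ifs with hij
  · subst hij
    rw [← mul_assoc, ← mul_inv, Real.mul_self_sqrt (h0 i).le, inv_mul_cancel₀ (h0 i).ne']
  · rw [show B (v i) (v j) = 0 from hv hij, mul_zero, mul_zero]

set_option linter.unusedSectionVars false

variable {E : Type*} [NormedAddCommGroup E] [NormedSpace ℝ E] [FiniteDimensional ℝ E]
  {S : Type*} [TopologicalSpace S] [ChartedSpace E S] [IsManifold 𝓘(ℝ, E) ∞ S]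
  {F : Type*} [NormedAddCommGroup F] [NormedSpace ℝ F] [FiniteDimensional ℝ F]
  {V : S → Type*} [TopologicalSpace (TotalSpace F V)]
  [∀ x, AddCommGroup (V x)] [∀ x, Module ℝ (V x)] [∀ x, TopologicalSpace (V x)]
  [∀ x, IsTopologicalAddGroup (V x)] [∀ x, ContinuousSMul ℝ (V x)]
  [FiberBundle F V] [VectorBundle ℝ F V] [ContMDiffVectorBundle ∞ F V 𝓘(ℝ, E)]

theorem dCoframe_sub [T2Space S] (η : LorentzMetric E F V) (e : BoundaryCoframe E F V)
    (ω₀ : CovariantDerivative 𝓘(ℝ, E) F V) {A B : FormField E V} (hA : A ∈ Omega E F V 1 2)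
    (hB : B ∈ Omega E F V 1 2) :
    dCoframe η e ω₀ (A - B) = dCoframe η e ω₀ A - rho η e B := by
  rw [dCoframe_eq η e ω₀ hA, dCoframe_eq η e ω₀ (Submodule.sub_mem _ hA hB), map_sub]
  abel

theorem mem_kerW_iff {e : BoundaryCoframe E F V} {k i j : ℕ} {X : FormField E V} :
    X ∈ kerW e k i j ↔ X ∈ Omega E F V i j ∧ coframeForm e ^ k * X = 0 := by
  rw [(commute_coframeForm_pow e k X).eq]
  exact Iff.rfl

theorem eq_zero_of_mem_imW (hd : finrank ℝ E + 1 = finrank ℝ F) {e : BoundaryCoframe E F V}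
    (en : TransversalSection E F V e) {k : ℕ} (hk : k + 3 = finrank ℝ E) {Y : FormField E V}
    (hY : Y ∈ kerW e (k + 1) 2 1)
    (h : transversalForm en * coframeForm e ^ k * Y ∈ imW e (k + 1) 1 1) : Y = 0 := by
  rw [mem_kerW_iff] at hY
  obtain ⟨X, hX, hXY⟩ := h
  replace hXY : coframeForm e ^ (k + 1) * X = transversalForm en * coframeForm e ^ k * Y :=
    (commute_coframeForm_pow e (k + 1) X).eq.trans hXY
  funext x
  obtain ⟨s⟩ := nonempty_splitting_coframe hd en x
  exact eq_zero_of_mul_eq (b := tangentBasis x) s (by rw [hk, Fintype.card_fin]) (hX.1 x)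
    (hY.1.1 x) (congrFun hY.2 x) (congrFun hXY x).symm

/-- The orthogonal projection to a subspace of `ker W_{N-3}` vanishes on
`e Ω^{1,0} + Ω^{2,0} e_n`. -/
theorem proj_eq_zero (hd : finrank ℝ E + 1 = finrank ℝ F) {e : BoundaryCoframe E F V}
    (en : TransversalSection E F V e) {k : ℕ} (hk : k + 2 = finrank ℝ E)
    {h : ContMDiffRiemannianMetric 𝓘(ℝ, E) ∞ E (TangentSpace 𝓘(ℝ, E) : S → Type _)}
    {G : ContMDiffRiemannianMetric 𝓘(ℝ, E) ∞ F V} (hG : ExtendsMetric e en h G)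
    {T : Submodule ℝ (FormField E V)} (hT : T ≤ kerW e k 2 1)
    {p : FormField E V →ₗ[ℝ] FormField E V} (hp : IsOrthogonalProjection21 h G T p)
    {α β : FormField E V} (hα : α ∈ Omega E F V 1 0) (hβ : β ∈ Omega E F V 2 0) :
    p (coframeForm e * α + β * transversalForm en) = 0 := by
  set Z := coframeForm e * α + β * transversalForm en with hZ
  have hZm : Z ∈ Omega E F V 2 1 := Submodule.add_mem _ (mul_mem_Omega (coframeForm_mem e) hα :)
    (mul_mem_Omega hβ (transversalForm_mem en) :)
  have hθT : p Z ∈ T := hp.1.2.1 Z hZm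
  have hθ := mem_kerW_iff.mp (hT hθT)
  have ho := hp.2 Z hZm _ hθT
  funext x
  have : FiniteDimensional ℝ (TangentSpace 𝓘(ℝ, E) x) := inferInstanceAs (FiniteDimensional ℝ E)
  let H : TangentSpace 𝓘(ℝ, E) x →ₗ[ℝ] TangentSpace 𝓘(ℝ, E) x →ₗ[ℝ] ℝ :=
    ContinuousLinearMap.coeLM ℝ ∘ₗ
      (h.inner x : TangentSpace 𝓘(ℝ, E) x →ₗ[ℝ] TangentSpace 𝓘(ℝ, E) x →L[ℝ] ℝ)
  obtain ⟨b, hb⟩ : ∃ b : Basis (Fin (finrank ℝ E)) ℝ (TangentSpace 𝓘(ℝ, E) x),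
      ∀ i j, h.inner x (b i) (b j) = if i = j then 1 else 0 :=
    exists_basis_orthonormal H (h.symm x) (h.pos x)
  obtain ⟨s⟩ := nonempty_splitting_coframe hd en x
  let B : V x →ₗ[ℝ] V x →ₗ[ℝ] ℝ :=
    ContinuousLinearMap.coeLM ℝ ∘ₗ (G.inner x : V x →ₗ[ℝ] V x →L[ℝ] ℝ)
  have hB (i) (u : TangentSpace 𝓘(ℝ, E) x) :
      B (coframeAt e x (b i)) (coframeAt e x u) = b.coord i u := by
    change G.inner x (e.toFun x (b i)) (e.toFun x u) = _
    rw [(hG x (b i)).2 u]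
    have hH (j) : H (b i) (b j) = if i = j then 1 else 0 := hb i j
    change H (b i) u = _
    conv_lhs => rw [← b.sum_repr u]
    simp only [map_sum, map_smul, hH, smul_eq_mul, mul_ite, mul_one, mul_zero]
    simp
  obtain ⟨ξ, hξ⟩ := exists_cv_of_mem_bideg (hα.1 x)
  have h1 := sum_inner_ev_eq_zero s (b := b) (k := k) (by rw [hk, Fintype.card_fin]) B
    (fun u ↦ (hG x u).1) hB (hθ.1.1 x)
    (by rw [← coframeForm_eq]; exact congrFun hθ.2 x) ξ (hβ.1 x)
  have h2 : cof b (coframeAt e x) * cv _ _ ξ + β x * vc _ _ (en.toFun x) = Z x := by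
    rw [← coframeForm_eq, hξ]
    rfl
  rw [h2] at h1
  -- Both Z and Z − p Z are orthogonal to p Z, hence p Z has zero norm.
  have h3 : ∑ i, ∑ j, B (ev (Z x - p Z x) (b i) (b j)) (ev (p Z x) (b i) (b j)) = 0 := ho x b hb
  have h4 (u w) : ev (Z x - p Z x) u w = ev (Z x) u w - ev (p Z x) u w := by
    simp [ev]
  simp only [h4, map_sub, LinearMap.sub_apply, Finset.sum_sub_distrib] at h3
  rw [h1, zero_sub, neg_eq_zero] at h3
  have hB0 (v : V x) : 0 ≤ B v v := by
    rcases eq_or_ne v 0 with rfl | hv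
    · simp
    · exact (G.pos x v hv).le
  have hθx : p Z x ∈ bideg (TangentSpace 𝓘(ℝ, E) x) (V x) 2 1 := hθ.1.1 x
  suffices h6 : ∀ i j, ev (p Z x) (b i) (b j) = 0 from ev_eq_zero b hθx h6
  intro i j
  rw [Finset.sum_eq_zero_iff_of_nonneg fun i _ ↦ Finset.sum_nonneg fun j _ ↦ hB0 _] at h3
  have h5 := h3 i (Finset.mem_univ i)
  rw [Finset.sum_eq_zero_iff_of_nonneg fun j _ ↦ hB0 _] at h5
  by_contra hne
  exact (G.pos x _ hne).ne' (h5 j (Finset.mem_univ j))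

/-- The parameter `v` in the kernel of `p_𝒦` is determined by the structural constraint. -/
theorem eq_of_structural_constraint [T2Space S] (hd : finrank ℝ E + 1 = finrank ℝ F)
    {η : LorentzMetric E F V} {e : BoundaryCoframe E F V} (en : TransversalSection E F V e)
    (ω₀ : CovariantDerivative 𝓘(ℝ, E) F V) {k : ℕ} (hk : k + 3 = finrank ℝ E)
    {J : Submodule ℝ (FormField E V)} (hJ : imRho η e (k + 4) ⊓ J = ⊥)
    {pT : FormField E V →ₗ[ℝ] FormField E V}
    (hpT : ∀ α ∈ Omega E F V 2 1, pT α ∈ spaceT e (k + 4) J)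
    {pK : FormField E V →ₗ[ℝ] FormField E V} (hpK : ∀ α ∈ spaceK η e (k + 4), pK α = α)
    {A v v' : FormField E V} (hA : A ∈ Omega E F V 1 2)
    (hv : v ∈ kerW e (k + 1) 1 2) (hv' : v' ∈ kerW e (k + 1) 1 2)
    (h : transversalForm en * coframeForm e ^ k * dCoframe η e ω₀ (A - v)
      - transversalForm en * coframeForm e ^ k * pT (dCoframe η e ω₀ (A - v)) ∈ imW e (k + 1) 1 1)
    (h' : transversalForm en * coframeForm e ^ k * dCoframe η e ω₀ (A - v')
      - transversalForm en * coframeForm e ^ k * pT (dCoframe η e ω₀ (A - v')) ∈ imW e (k + 1) 1 1)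
    (h0 : pK v = 0) (h0' : pK v' = 0) : v = v' := by
  have e3 : k + 4 - 3 = k + 1 := by omega
  have hu : v - v' ∈ kerW e (k + 1) 1 2 := Submodule.sub_mem _ hv hv'
  have hρ := rho_mem_kerW η e hu
  have hT := hpT _ hρ.1
  have hT' := hT.1
  rw [e3] at hT'
  -- In the difference of the two constraints the torsion for A cancels and only ϱ(v − v') remains.
  have hY : rho η e (v - v') - pT (rho η e (v - v')) = 0 := by
    refine eq_zero_of_mem_imW hd en hk (Submodule.sub_mem _ hρ hT') ?_
    have := Submodule.sub_mem _ h' h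
    rw [dCoframe_sub η e ω₀ hA hv.1, dCoframe_sub η e ω₀ hA hv'.1] at this
    simp only [map_sub, mul_sub] at this ⊢
    convert this using 1
    abel
  have hmem : rho η e (v - v') ∈ imRho η e (k + 4) ⊓ J := by
    refine ⟨⟨v - v', ?_, rfl⟩, ?_⟩
    · rw [e3]
      exact hu
    · rw [sub_eq_zero.mp hY]
      exact hT.2
  rw [hJ, Submodule.mem_bot] at hmem
  have hK : v - v' ∈ spaceK η e (k + 4) := by
    refine ⟨?_, LinearMap.mem_ker.mpr hmem⟩
    rw [e3]
    exact hu
  have := hpK _ hK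
  rw [map_sub, h0, h0', sub_zero] at this
  exact sub_eq_zero.mp this.symm

end Main

end PalatiniCartan

end

/-! ### Existence and uniqueness of the splitting -/

open PalatiniCartan in
theorem mainTheorem3
    (N : ℕ) (hN : 4 ≤ N)
    {E : Type*} [NormedAddCommGroup E] [NormedSpace ℝ E] [FiniteDimensional ℝ E]
    (hE : Module.finrank ℝ E + 1 = N)
    {S : Type*} [TopologicalSpace S] [T2Space S] [SecondCountableTopology S]
    [ChartedSpace E S] [IsManifold 𝓘(ℝ, E) ∞ S]
    {F : Type*} [NormedAddCommGroup F] [NormedSpace ℝ F] [FiniteDimensional ℝ F]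
    (hF : Module.finrank ℝ F = N)
    {V : S → Type*} [TopologicalSpace (Bundle.TotalSpace F V)]
    [∀ x, AddCommGroup (V x)] [∀ x, Module ℝ (V x)] [∀ x, TopologicalSpace (V x)]
    [∀ x, IsTopologicalAddGroup (V x)] [∀ x, ContinuousSMul ℝ (V x)]
    [FiberBundle F V] [VectorBundle ℝ F V] [ContMDiffVectorBundle ∞ F V 𝓘(ℝ, E)]
    (η : LorentzMetric E F V)
    (e : BoundaryCoframe E F V)
    (hdeg : IsDegenerate η e)
    (en : TransversalSection E F V e)
    (ω₀ : CovariantDerivative 𝓘(ℝ, E) F V)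
    [CovariantDerivative.ContMDiffCovariantDerivative ω₀ ∞]
    (hω₀ : IsMetricConnection η ω₀)
    (h : Bundle.ContMDiffRiemannianMetric 𝓘(ℝ, E) ∞ E (TangentSpace 𝓘(ℝ, E) : S → Type _))
    (G : Bundle.ContMDiffRiemannianMetric 𝓘(ℝ, E) ∞ F V)
    (hG : ExtendsMetric e en h G)
    (J : Submodule ℝ (FormField E V))
    (hJ : IsComplement η e N J)
    (pT : FormField E V →ₗ[ℝ] FormField E V)
    (hpT : IsOrthogonalProjection21 h G (spaceT e N J) pT)
    (pK : FormField E V →ₗ[ℝ] FormField E V)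
    (hpK : IsProjection (Omega E F V 1 2) (spaceK η e N) pK)
    (ω' : FormField E V) (hω' : ω' ∈ Omega E F V 1 2) :
    ∃! p : FormField E V × FormField E V,
      p.1 ∈ Omega E F V 1 2 ∧ p.2 ∈ Omega E F V 1 2 ∧
      ω' = p.1 + p.2 ∧
      coframeForm e ^ (N - 3) * p.2 = 0 ∧
      transversalForm en * coframeForm e ^ (N - 4) * dCoframe η e ω₀ p.1
        - transversalForm en * coframeForm e ^ (N - 4) * pT (dCoframe η e ω₀ p.1)
        ∈ imW e (N - 3) 1 1 ∧
      pK p.2 = 0 := by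
  -- Now N − 3 = k + 1 and N − 4 = k, without truncated subtraction, and the rank of TΣ is k + 3.
  obtain ⟨k, rfl⟩ : ∃ k, N = k + 4 := ⟨N - 4, by omega⟩
  have hd : finrank ℝ E + 1 = finrank ℝ F := hE.trans hF.symm
  have e3 : k + 4 - 3 = k + 1 := by omega
  have e4 : k + 4 - 4 = k := by omega
  have hTker : spaceT e (k + 4) J ≤ kerW e (k + 1) 2 1 := by
    rw [spaceT, e3]
    exact inf_le_left
  obtain ⟨hKΩ, hKmem, hKid⟩ := hpK
  obtain ⟨hTΩ, hTmem, hTid⟩ := hpT.1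
  obtain ⟨hJ0, hJ1⟩ := hJ
  have hKrho {u} (hu : u ∈ spaceK η e (k + 4)) : rho η e u = 0 := LinearMap.mem_ker.mp hu.2
  have hKker {u} (hu : u ∈ spaceK η e (k + 4)) : coframeForm e ^ (k + 1) * u = 0 := by
    have := mem_kerW_iff.mp hu.1
    rw [e3] at this
    exact this.2
  rw [e3, e4]
  obtain ⟨α, hα, β, hβ, hdec⟩ := exists_smooth_decomposition hd en (k := k + 1) (by omega)
    (dCoframe_mem η e ω₀ hω')
  have hQ := dCoframe_mem η e ω₀ hω'
  set Q := dCoframe η e ω₀ ω'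
  have hZ : coframeForm e * α + β * transversalForm en ∈ Omega E F V 2 1 :=
    Submodule.add_mem _ (mul_mem_Omega (coframeForm_mem e) hα :)
      (mul_mem_Omega hβ (transversalForm_mem en) :)
  set Z := coframeForm e * α + β * transversalForm en with hZd
  rw [sub_sub, ← hZd] at hdec
  have hQ0 : Q - Z ∈ Omega E F V 2 1 := Submodule.sub_mem _ hQ hZ
  have hQ0' := hQ0
  rw [← hJ1] at hQ0'
  obtain ⟨_, ⟨v, hv, rfl⟩, t, ht, hvt⟩ := Submodule.mem_sup.mp hQ0'
  rw [e3] at hv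
  -- Both Q − Z and ϱ(v) lie in the kernel, hence so does the J-component t.
  have htK : t ∈ spaceT e (k + 4) J := by
    refine ⟨?_, ht⟩
    rw [e3, eq_sub_of_add_eq' hvt]
    exact Submodule.sub_mem _ (mem_kerW_iff.mpr ⟨hQ0, hdec⟩) (rho_mem_kerW η e hv)
  have hv' := mem_kerW_iff.mp hv
  have hpv := hKmem v hv'.1
  -- The correction by p_𝒦 v ∈ 𝒦 normalises v without changing ϱ(v) or leaving the kernel of
  -- e^{N-3}.
  have hwm : v - pK v ∈ Omega E F V 1 2 := Submodule.sub_mem _ hv'.1 (hKΩ hpv)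
  have hrw : rho η e (v - pK v) = rho η e v := by rw [map_sub, hKrho hpv, sub_zero]
  have hwe : coframeForm e ^ (k + 1) * (v - pK v) = 0 := by
    rw [mul_sub, hv'.2, hKker hpv, sub_zero]
  have hwp : pK (v - pK v) = 0 := by rw [map_sub, hKid _ hpv, sub_self]
  have hwc : transversalForm en * coframeForm e ^ k * dCoframe η e ω₀ (ω' - (v - pK v))
      - transversalForm en * coframeForm e ^ k * pT (dCoframe η e ω₀ (ω' - (v - pK v)))
      ∈ imW e (k + 1) 1 1 := by
    have hD : dCoframe η e ω₀ (ω' - (v - pK v)) = t + Z := by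
      rw [dCoframe_sub η e ω₀ hω' hwm, hrw, eq_sub_of_add_eq' hvt]
      abel
    have hpZ : pT Z = 0 := proj_eq_zero hd en (k := k + 1) (by omega) hG hTker hpT hα hβ
    -- After p_𝒯 removes t, what is left is e_n e^k (eα + βe_n) = (e_n α) e^{k+1}, because e_n e_n =
    -- 0.
    refine ⟨transversalForm en * α, (mul_mem_Omega (transversalForm_mem en) hα :), ?_⟩
    have hβn : β * transversalForm en = transversalForm en * β :=
      funext fun x ↦ vc_mul_comm (hβ.1 x) (en.toFun x)
    have hnn : transversalForm en * transversalForm en = 0 := funext fun x ↦ vc_mul_self _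
    have h1 : transversalForm en * coframeForm e ^ k * (β * transversalForm en) = 0 := by
      rw [mul_assoc, (commute_coframeForm_pow e k _).eq, hβn, mul_assoc, ← mul_assoc, hnn, zero_mul]
    rw [← mul_sub, hD, map_add, hTid t htK, hpZ, add_zero, add_sub_cancel_left, hZd, mul_add, h1,
      add_zero, ← mul_assoc, mul_assoc (transversalForm en), ← pow_succ, mul_assoc,
      (commute_coframeForm_pow e (k + 1) α).eq, ← mul_assoc]
    rfl
  refine ⟨(ω' - (v - pK v), v - pK v), ⟨Submodule.sub_mem _ hω' hwm, hwm,
    (sub_add_cancel _ _).symm, hwe, hwc, hwp⟩, ?_⟩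
  rintro ⟨p₁, p₂⟩ ⟨h1, h2, h3, h4, h5, h6⟩
  dsimp only at h1 h2 h3 h4 h5 h6
  obtain rfl : p₁ = ω' - p₂ := eq_sub_of_add_eq h3.symm
  have hp : p₂ = v - pK v := eq_of_structural_constraint hd en ω₀ (by omega) hJ0 hTmem hKid hω'
      (mem_kerW_iff.mpr ⟨h2, h4⟩) (mem_kerW_iff.mpr ⟨hwm, hwe⟩) h5 hwc h6 hwp
  rw [hp]
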